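/- **Setting.** Let $\mu$ be the normalized surface measure on the unit sphere $\mathbb S^2\subset\mathbb R^3$, let $Y_{\ell,m}$ ($\ell\in\mathbb N_0$, $-\ell\le m\le \ell$) be the complex spherical harmonics, orthonormal in $L_2(\mathbb S^2,\mu)$, let $\lambda_\ell=\ell(\ell+1)$, let $\alpha\in(0,1]$, $\tau>0$, and let $E_\alpha(z)=\sum_{k\ge0} z^k/\Gamma(\alpha k+1)$ be the Mittag-Leffler function. On a probability space $(\Omega,\mathcal F,\mathbb P)$ let * $\xi\in L_2(\Omega\times\mathbb S^2)$ be a real, jointly measurable, centered, strongly isotropic Gaussian random field on $\mathbb S^2$ with Fourier coefficients $\widehat\xi_{\ell,m}=\int_{\mathbb S^2}\xi\,\overline{Y_{\ell,m}}\,d\mu$ and angular power spectrum $\mathcal C_\ell=\mathbb E|\widehat\xi_{\ell,m}|^2$; * $W_\tau(t)$, $t\ge\tau$, be an $L_2(\mathbb S^2)$-valued $Q$-Wiener process started from $0$ at time $\tau$ (continuous paths, independent increments, $W_\tau(t)-W_\tau(s)\sim\mathcal N(0,(t-s)Q)$ for $t\ge s\ge\tau$), independent of $\xi$, with $QY_{\ell,m}=\mathcal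 A_\ell Y_{\ell,m}$; let $W_0(s)=W_\tau(\tau+s)$ for $s\ge 0$, and let $\widehat W_{\ell,m,0}$ be the Fourier coefficients of $W_0$. Assume that, for some $\kappa_1,\kappa_2>2$ and $\widetilde D,\widetilde C,\widetilde K,\widetilde A>0$, $$\mathcal C_0\le\widetilde D,\quad \mathcal C_\ell\le\widetilde C\ell^{-\kappa_1},\qquad \mathcal A_0\le\widetilde K,\quad \mathcal A_\ell\le\widetilde A\ell^{-\kappa_2}\qquad(\ell\ge1),$$ and put $$\widetilde C_{\kappa_1}=\Big(\widetilde C\Big(\tfrac{2}{\kappa_1-2}+\tfrac1{\kappa_1-1}\Big)\Big)^{1/2},\qquad \widetilde A_{\kappa_2}=\Big(\widetilde A\Big(\tfrac{2}{\kappa_2-2}+\tfrac1{\kappa_2-1}\Big)\Big)^{1/2}.$$ Let $U(t)=U^H(t)+U^I(t)$, $t>0$, be the solution of the time-fractional stochastic diffusion equation $$dU(t)-D_t^{1-\alpha}\Delta_{\mathbb S^2}U(t)\,dt=\begin{cases}0,&0<t\le\tau,\\ dW_\tau(t),&t\ge\tau,\end{cases}\qquad U(0)=\xi,$$ that is given by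 the following series, convergent in $L_2(\Omega\times\mathbb S^2)$: $$U^H(t)=\sum_{\ell=0}^\infty\sum_{m=-\ell}^{\ell}E_\alpha(-\lambda_\ell t^\alpha)\,\widehat\xi_{\ell,m}Y_{\ell,m},$$ $$U^I(t)=0\ (t\le\tau),\qquad U^I(t)=\sum_{\ell=0}^\infty\sum_{m=-\ell}^{\ell}\Big(\int_0^{t-\tau}E_\alpha(-\lambda_\ell(t-\tau-s)^\alpha)\,d\widehat W_{\ell,m,0}(s)\Big)Y_{\ell,m}\ (t>\tau),$$ where the integrals are Wiener integrals. **Theorem 6.1.** There is a constant $C>0$, depending only on $\alpha$, $\kappa_1$, $\kappa_2$ and an upper bound for the ratio $\widetilde K/\widetilde A$ (in particular not on $t$, $h$, $\tau$, the probability space, $\xi$ or $W_\tau$), such that for all $t>\tau$ and all $h>0$ $$\|U(t+h)-U(t)\|_{L_2(\Omega\times\mathbb S^2)}\le q(t)\,h^{1/2},\qquad q(t)=\sqrt{C\,\widetilde C_{\kappa_1}^2\,t^{-1}+(1+C)\,\widetilde A_{\kappa_2}^2}.$$ -/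

import Mathlib

open MeasureTheory ProbabilityTheory Filter Topology

noncomputable section

namespace SphereDiffusion

/-! ### The unit sphere and its normalized surface measure -/

/-- Euclidean three-space. -/
abbrev E3 : Type := EuclideanSpace ℝ (Fin 3)

/-- The unit sphere of Euclidean three-space. -/
abbrev S2 : Type := Metric.sphere (0 : E3) 1

/-- The surface measure on the unit sphere, normalized to total mass one. -/
def sphereMeasure : Measure S2 :=
  ((volume : Measure E3).toSphere Set.univ)⁻¹ • (volume : Measure E3).toSphere

instance : IsProbabilityMeasure sphereMeasure := by
  constructor
  have h0 : (volume : Measure E3).toSphere Set.univ ≠ 0 :=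
    Measure.measure_univ_ne_zero.2 (Measure.toSphere_ne_zero (volume : Measure E3))
  have h1 : (volume : Measure E3).toSphere Set.univ ≠ ⊤ := measure_ne_top _ _
  simp only [sphereMeasure, Measure.smul_apply, smul_eq_mul]
  exact ENNReal.inv_mul_cancel h0 h1

/-- The real Hilbert space of square integrable real functions on the sphere. -/
abbrev L2S : Type := Lp ℝ 2 sphereMeasure

instance : MeasurableSpace L2S := borel L2S

instance : BorelSpace L2S := ⟨rfl⟩

/-! ### Spherical harmonics -/

/-- The Legendre polynomial of degree `l`, by the Rodrigues formula. -/
def legendre (l : ℕ) : Polynomial ℝ :=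
  Polynomial.C (((2 : ℝ) ^ l * (l.factorial : ℝ))⁻¹) *
    (Polynomial.derivative^[l]) ((Polynomial.X ^ 2 - 1) ^ l)

/-- The spherical harmonic of degree `l` and order `m ≥ 0`. With polar angle `θ` and azimuth `φ`
one has `x 2 = cos θ` and `(x 0 + i x 1) ^ m = (sin θ) ^ m * exp (i m φ)`, so that the last three
factors are the associated Legendre function at `cos θ`, which is
`(-1) ^ m * (sin θ) ^ m * P_l^{(m)} (cos θ)`, times `exp (i m φ)`. -/
def sphericalHarmonicNonneg (l m : ℕ) (x : S2) : ℂ :=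
  (Real.sqrt ((2 * (l : ℝ) + 1) * ((l - m).factorial : ℝ) / ((l + m).factorial : ℝ)) : ℂ) *
    ((-1 : ℂ) ^ m *
      (((Polynomial.derivative^[m] (legendre l)).eval ((x : E3) 2) : ℝ) : ℂ) *
      ((((x : E3) 0 : ℝ) : ℂ) + Complex.I * (((x : E3) 1 : ℝ) : ℂ)) ^ m)

/-- The complex spherical harmonic of degree `l` and order `m`, where `-l ≤ m ≤ l`. -/
def sphericalHarmonic (l : ℕ) (m : ℤ) (x : S2) : ℂ :=
  if 0 ≤ m then sphericalHarmonicNonneg l m.natAbs x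
  else (-1 : ℂ) ^ m.natAbs * starRingEnd ℂ (sphericalHarmonicNonneg l m.natAbs x)

/-- The Fourier coefficient of a real function on the sphere. -/
def fourierCoeff (f : S2 → ℝ) (l : ℕ) (m : ℤ) : ℂ :=
  ∫ x, (f x : ℂ) * starRingEnd ℂ (sphericalHarmonic l m x) ∂sphereMeasure

/-- The eigenvalue `l (l + 1)` of the negative Laplace-Beltrami operator. -/
def eigenvalue (l : ℕ) : ℝ := (l : ℝ) * ((l : ℝ) + 1)

/-- The Mittag-Leffler function `E_α` at a real argument. -/
def mittagLeffler (α z : ℝ) : ℝ := ∑' k : ℕ, z ^ k / Real.Gamma (α * (k : ℝ) + 1)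

/-! ### Random fields and noise -/

section Probability

variable {Ω : Type*} [MeasurableSpace Ω]

/-- A centered, strongly isotropic Gaussian random field on the sphere, jointly measurable and
square integrable. -/
structure IsIsotropicGaussianField (P : Measure Ω) (ξ : Ω → S2 → ℝ) : Prop where
  measurable : Measurable (fun z : Ω × S2 => ξ z.1 z.2)
  memLp : MemLp (fun z : Ω × S2 => ξ z.1 z.2) 2 (P.prod sphereMeasure)
  gaussian : IsGaussianProcess (fun (x : S2) (ω : Ω) => ξ ω x) P
  centered : ∀ x : S2, ∫ ω, ξ ω x ∂P = 0
  /-- For every rotation `R`, the finite-dimensional laws at `x i` and at `R (x i)` agree. -/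
  isotropic : ∀ R ∈ Matrix.specialOrthogonalGroup (Fin 3) ℝ,
    ∀ (k : ℕ) (x y : Fin k → S2),
      (∀ i, ((y i : E3) : Fin 3 → ℝ) = Matrix.mulVec R ((x i : E3) : Fin 3 → ℝ)) →
      IdentDistrib (fun ω i => ξ ω (x i)) (fun ω i => ξ ω (y i)) P P

/-- `c` is the angular power spectrum of `ξ`: `c l` is the second absolute moment of each Fourier
coefficient of degree `l`. -/
def HasAngularPowerSpectrum (P : Measure Ω) (ξ : Ω → S2 → ℝ) (c : ℕ → ℝ) : Prop :=
  ∀ (l : ℕ) (m : ℤ), -(l : ℤ) ≤ m → m ≤ (l : ℤ) → ∫ ω, ‖fourierCoeff (ξ ω) l m‖ ^ 2 ∂P = c l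

/-- `W` is a `Q`-Wiener process on `[τ, ∞)` with values in the space of real square integrable
functions on the sphere. A random element `X` of that space has the law `N(0, S)` exactly if
`⟪X, f⟫` has the law `N(0, ⟪S f, f⟫)` for every `f`. -/
structure IsDelayedQWiener (P : Measure Ω) (τ : ℝ) (Q : L2S →L[ℝ] L2S) (W : ℝ → Ω → L2S) :
    Prop where
  measurable : ∀ t, τ ≤ t → Measurable (W t)
  start : ∀ᵐ ω ∂P, W τ ω = 0
  continuous : ∀ᵐ ω ∂P, ContinuousOn (fun t => W t ω) (Set.Ici τ)
  indep_increments : HasIndepIncrements (fun t : Set.Ici τ => W (t : ℝ)) P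
  law_increments : ∀ s t : ℝ, τ ≤ s → s ≤ t → ∀ f : L2S,
    HasLaw (fun ω => inner ℝ (W t ω - W s ω) f)
      (gaussianReal 0 (Real.toNNReal ((t - s) * inner ℝ (Q f) f))) P

/-- `Q` is a covariance operator (positive and self-adjoint) whose complexification satisfies
`Q Y_{l,m} = a_l Y_{l,m}` for all spherical harmonics. As `Q` acts on real functions, this is
written for the real and the imaginary part of `Y_{l,m}`. -/
structure IsIsotropicCovariance (Q : L2S →L[ℝ] L2S) (a : ℕ → ℝ) : Prop where
  positive : Q.IsPositive
  eigen_re : ∀ (l : ℕ) (m : ℤ), -(l : ℤ) ≤ m → m ≤ (l : ℤ) → ∀ f : L2S,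
    (f : S2 → ℝ) =ᵐ[sphereMeasure] (fun x => (sphericalHarmonic l m x).re) → Q f = a l • f
  eigen_im : ∀ (l : ℕ) (m : ℤ), -(l : ℤ) ≤ m → m ≤ (l : ℤ) → ∀ f : L2S,
    (f : S2 → ℝ) =ᵐ[sphereMeasure] (fun x => (sphericalHarmonic l m x).im) → Q f = a l • f

/-! ### Wiener integrals of deterministic functions -/

/-- A step function on `[a, b]`: it has the value `val i` on `(node i, node (i + 1)]`, `i < n`,
where `a = node 0 ≤ node 1 ≤ ... ≤ node n = b`. -/
structure StepFunction (a b : ℝ) where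
  n : ℕ
  node : ℕ → ℝ
  mono : Monotone node
  node_zero : node 0 = a
  node_last : node n = b
  val : ℕ → ℝ

/-- The function described by a step function. -/
def StepFunction.toFun {a b : ℝ} (s : StepFunction a b) (u : ℝ) : ℝ :=
  ∑ i ∈ Finset.range s.n, (Set.Ioc (s.node i) (s.node (i + 1))).indicator (fun _ => s.val i) u

/-- The integral of a step function with respect to a process. -/
def StepFunction.integral {a b : ℝ} (s : StepFunction a b) (B : ℝ → Ω → ℂ) (ω : Ω) : ℂ :=
  ∑ i ∈ Finset.range s.n, (s.val i : ℂ) * (B (s.node (i + 1)) ω - B (s.node i) ω)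

/-- `I` is (a version of) the Wiener integral `∫_a^b g(u) dB(u)`: the mean square limit of the
integrals of step functions that converge to `g` in `L²([a, b])`. -/
def IsWienerIntegral (P : Measure Ω) (B : ℝ → Ω → ℂ) (a b : ℝ) (g : ℝ → ℝ) (I : Ω → ℂ) : Prop :=
  MemLp I 2 P ∧ ∃ s : ℕ → StepFunction a b,
    Tendsto (fun k => eLpNorm (fun u => (s k).toFun u - g u) 2 (volume.restrict (Set.Icc a b)))
      atTop (𝓝 0) ∧
    Tendsto (fun k => eLpNorm (fun ω => I ω - (s k).integral B ω) 2 P) atTop (𝓝 0)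

/-! ### The solution of the diffusion equation -/

/-- `u` is the sum of the series `∑_l ∑_{|m| ≤ l} b l m * Y_{l,m}` with random coefficients, in the
sense of convergence in the `L²` space of the product of the probability space and the sphere. -/
def IsL2Expansion (P : Measure Ω) (b : ℕ → ℤ → Ω → ℂ) (u : Ω × S2 → ℝ) : Prop :=
  MemLp u 2 (P.prod sphereMeasure) ∧
    Tendsto (fun L : ℕ => eLpNorm (fun z : Ω × S2 => (u z : ℂ) -
        ∑ l ∈ Finset.range (L + 1), ∑ m ∈ Finset.Icc (-(l : ℤ)) (l : ℤ),
          b l m z.1 * sphericalHarmonic l m z.2) 2 (P.prod sphereMeasure))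
      atTop (𝓝 0)

/-- The homogeneous part, with the coefficients `E_α(-λ_l t^α) ξ_{l,m}`. -/
def IsHomogeneousPart (P : Measure Ω) (α : ℝ) (ξ : Ω → S2 → ℝ) (UH : ℝ → Ω × S2 → ℝ) : Prop :=
  ∀ t : ℝ, 0 < t → IsL2Expansion P
    (fun l m ω => (mittagLeffler α (-eigenvalue l * t ^ α) : ℂ) * fourierCoeff (ξ ω) l m) (UH t)

/-- The inhomogeneous part: it vanishes up to time `τ`, and for `t > τ` its coefficients are the
Wiener integrals `∫_0^{t-τ} E_α(-λ_l (t-τ-s)^α) dW_{l,m}(s)`, where `W_{l,m}(s)` is the Fourier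
coefficient of `W(τ + s)`. -/
def IsInhomogeneousPart (P : Measure Ω) (α τ : ℝ) (W : ℝ → Ω → L2S) (UI : ℝ → Ω × S2 → ℝ) :
    Prop :=
  (∀ t : ℝ, 0 < t → t ≤ τ → UI t =ᵐ[P.prod sphereMeasure] 0) ∧
  ∀ t : ℝ, τ < t → ∃ J : ℕ → ℤ → Ω → ℂ,
    (∀ (l : ℕ) (m : ℤ), -(l : ℤ) ≤ m → m ≤ (l : ℤ) →
      IsWienerIntegral P (fun s ω => fourierCoeff (W (τ + s) ω) l m) 0 (t - τ)
        (fun s => mittagLeffler α (-eigenvalue l * (t - τ - s) ^ α)) (J l m)) ∧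
    IsL2Expansion P J (UI t)

/-- The solution of the time-fractional stochastic diffusion equation with initial field `ξ` and
noise `W` switched on at time `τ`, as the sum of the homogeneous and the inhomogeneous part. -/
def IsSolution (P : Measure Ω) (α τ : ℝ) (ξ : Ω → S2 → ℝ) (W : ℝ → Ω → L2S)
    (U : ℝ → Ω × S2 → ℝ) : Prop :=
  ∃ UH UI : ℝ → Ω × S2 → ℝ, IsHomogeneousPart P α ξ UH ∧ IsInhomogeneousPart P α τ W UI ∧
    ∀ t : ℝ, 0 < t → U t =ᵐ[P.prod sphereMeasure] fun z => UH t z + UI t z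

end Probability

/-- The constant `(A (2 / (κ - 2) + 1 / (κ - 1)))^{1/2}` of a spectrum bounded by `A l^{-κ}`. -/
def spectralConst (A κ : ℝ) : ℝ := Real.sqrt (A * (2 / (κ - 2) + 1 / (κ - 1)))

end SphereDiffusion

end

noncomputable section

namespace SphereDiffusion

/-! Spherical harmonics decouple the equation: the modes of degree l relax through r(t) = E_α(-λ_l
t^α). By orthonormality, a squared L² norm is the sum over modes of the second moments of the
coefficients (`lintegral_expansion`), and each degree occurs 2l + 1 times. Since ∑ (2l+1) l^(-κ) is
finite for κ > 2, it is enough to bound the mean square increment of each mode by its spectrum times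
a multiple of h that does not depend on l.

Three facts about r suffice: it takes values in [0, 1], it decreases, and r(t) - r(t+h) ≤ h/t
(`relaxation_sub_le`). In the homogeneous part, r(t) - r(t+h) lies in [0, 1], so its square is at
most itself, hence at most h/t. In the inhomogeneous part, the Wiener isometry
(`eLpNorm_wienerIntegral_sub_le`) reduces the question to the L² distance of two shifted kernels. On
the old time window the squared difference is at most the difference, whose integral telescopes to
at most h. The new window has length h and a kernel of size at most 1 (`eLpNorm_relaxation_sub_le`).
Minkowski's inequality joins the two parts.

The facts about r come from a discretization instead of contour integrals. The coefficients of
(1-z)^(α-1) / ((1-z)^α + μ) solve the backward difference scheme for fractional relaxation. For 0 <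
α ≤ 1 the signs of the binomial coefficients make this sequence nonnegative and decreasing, and
differentiating the generating function bounds its drop at step n by 1/n (`mul_relaxResolvent_le`).
With μ = λ N^(-α) and index ⌊tN⌋ the sequence converges to r(t) (`tendsto_relaxSeq`), and all the
inequalities pass to the limit.

Orthonormality is derived from the explicit formulas: rotations about the polar axis separate the
orders, and for equal orders the integrals reduce to Legendre integrals over [-1, 1], because the
height is uniformly distributed on the sphere (`integral_sphere_polynomial`). -/

/-! ### Coefficients of `(1 - z) ^ (-x)` -/

/-- The coefficient of `z ^ n` in `(1 - z) ^ (-x)`. -/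
def negBinom (x : ℝ) (n : ℕ) : ℝ := ∏ j ∈ Finset.range n, (x + j) / (j + 1)

theorem negBinom_zero (x : ℝ) : negBinom x 0 = 1 := by simp [negBinom]

theorem negBinom_succ (x : ℝ) (n : ℕ) :
    negBinom x (n + 1) = negBinom x n * ((x + n) / (n + 1)) := by
  rw [negBinom, Finset.prod_range_succ, ← negBinom]

theorem factorial_mul_negBinom (x : ℝ) (n : ℕ) :
    (n.factorial : ℝ) * negBinom x n = (ascPochhammer ℝ n).eval x := by
  induction n with
  | zero => simp [negBinom]
  | succ n ih =>
    rw [ascPochhammer_succ_eval, ← ih, negBinom_succ, Nat.factorial_succ]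
    push_cast
    field_simp

theorem negBinom_eq_multichoose (x : ℝ) (n : ℕ) : negBinom x n = Ring.multichoose x n := by
  have h := Ring.factorial_nsmul_multichoose_eq_ascPochhammer x n
  rw [Polynomial.ascPochhammer_smeval_eq_eval, nsmul_eq_mul] at h
  exact mul_left_cancel₀ (by positivity) ((factorial_mul_negBinom x n).trans h.symm)

/-- The power series of `(1 - z) ^ (-x)`. -/
def negBinomSeries (x : ℝ) : PowerSeries ℝ := PowerSeries.mk (negBinom x)

/-- The sign in choose(-x, n) = (-1)^n multichoose(x, n) is absorbed by z ↦ -z. This makes the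
exponent law of the binomial series available. -/
theorem negBinomSeries_eq_rescale (x : ℝ) :
    negBinomSeries x = PowerSeries.rescale (-1 : ℝ) (PowerSeries.binomialSeries ℝ (-x)) := by
  ext n
  rw [negBinomSeries, PowerSeries.coeff_mk, PowerSeries.coeff_rescale,
    PowerSeries.binomialSeries_coeff, Ring.choose_neg', negBinom_eq_multichoose]
  rcases Nat.even_or_odd n with h | h
  · simp [h.neg_one_pow, Int.negOnePow_even _ ((Int.even_coe_nat n).2 h)]
  · simp [h.neg_one_pow, Int.negOnePow_odd _ ((Int.odd_coe_nat n).2 h)]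

theorem negBinomSeries_add (x y : ℝ) :
    negBinomSeries (x + y) = negBinomSeries x * negBinomSeries y := by
  rw [negBinomSeries_eq_rescale, negBinomSeries_eq_rescale, negBinomSeries_eq_rescale, neg_add,
    PowerSeries.binomialSeries_add, map_mul]

theorem negBinom_add (x y : ℝ) (n : ℕ) :
    negBinom (x + y) n = ∑ p ∈ Finset.HasAntidiagonal.antidiagonal n, negBinom x p.1 * negBinom y p.2 := by
  have h := congrArg (PowerSeries.coeff n) (negBinomSeries_add x y)
  simpa [negBinomSeries, PowerSeries.coeff_mul] using h

theorem negBinomSeries_neg_one : negBinomSeries (-1) = 1 - PowerSeries.X := by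
  ext n
  rw [negBinomSeries, PowerSeries.coeff_mk, map_sub, PowerSeries.coeff_one, PowerSeries.coeff_X]
  match n with
  | 0 => simp [negBinom]
  | 1 => simp [negBinom]
  | n + 2 =>
    have : negBinom (-1) (n + 2) = 0 :=
      Finset.prod_eq_zero (i := 1) (by simp) (by simp)
    simp [this]

theorem negBinom_nonneg {x : ℝ} (hx : 0 ≤ x) (n : ℕ) : 0 ≤ negBinom x n :=
  Finset.prod_nonneg fun j _ => by positivity

/-- Coefficientwise form of d/dz (1-z)^α = -α (1-z)^(α-1). It also shows that, for 0 < α ≤ 1, all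
coefficients of (1-z)^α after the constant one are nonpositive. -/
theorem negBinom_neg_succ (α : ℝ) (n : ℕ) :
    ((n : ℝ) + 1) * negBinom (-α) (n + 1) = -α * negBinom (1 - α) n := by
  induction n with
  | zero => simp [negBinom]
  | succ n ih =>
    rw [negBinom_succ, negBinom_succ (1 - α)]
    push_cast at ih ⊢
    have h1 : ((n : ℝ) + 1) ≠ 0 := by positivity
    have h2 : ((n : ℝ) + 1 + 1) ≠ 0 := by positivity
    field_simp
    field_simp at ih
    linear_combination (1 + n - α) * ih

theorem negBinom_le {x : ℝ} (hx : 0 ≤ x) (n : ℕ) : negBinom x n ≤ (x + 1) ^ n := by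
  rw [negBinom, ← Finset.card_range n, ← Finset.prod_const, Finset.card_range]
  refine Finset.prod_le_prod (fun j _ => by positivity) fun j _ => ?_
  rw [div_le_iff₀ (by positivity)]
  nlinarith [mul_nonneg hx (Nat.cast_nonneg (α := ℝ) j)]

/-! ### A discrete relaxation sequence -/

section Relaxation

variable {α μ : ℝ}

/-- The power series of `(1 - z) ^ α + μ`. -/
def relaxDenom (α μ : ℝ) : PowerSeries ℝ := negBinomSeries (-α) + PowerSeries.C μ

/-- The coefficients of `((1 - z) ^ α + μ)⁻¹`. -/
def relaxResolvent (α μ : ℝ) (n : ℕ) : ℝ := PowerSeries.coeff n (relaxDenom α μ)⁻¹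

/-- The coefficients of `(1 - z) ^ (α - 1) / ((1 - z) ^ α + μ)`. -/
def relaxSeq (α μ : ℝ) (n : ℕ) : ℝ :=
  PowerSeries.coeff n (negBinomSeries (1 - α) * (relaxDenom α μ)⁻¹)

theorem constantCoeff_relaxDenom (α μ : ℝ) :
    PowerSeries.constantCoeff (relaxDenom α μ) = 1 + μ := by
  rw [relaxDenom, map_add, ← PowerSeries.coeff_zero_eq_constantCoeff_apply, negBinomSeries,
    PowerSeries.coeff_mk, negBinom_zero]
  simp

theorem relaxDenom_mul_inv (hμ : 0 ≤ μ) : relaxDenom α μ * (relaxDenom α μ)⁻¹ = 1 :=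
  PowerSeries.mul_inv_cancel _ (by rw [constantCoeff_relaxDenom]; positivity)

/-- The denominator has positive constant coefficient 1 + μ and nonpositive coefficients afterwards.
The recursion for its inverse therefore writes each new coefficient as a nonnegative combination of
earlier ones. -/
theorem relaxResolvent_nonneg (hα : 0 < α) (hα1 : α ≤ 1) (hμ : 0 ≤ μ) (n : ℕ) :
    0 ≤ relaxResolvent α μ n := by
  induction n using Nat.strong_induction_on with
  | _ n ih =>
    have h := congrArg (PowerSeries.coeff n) (relaxDenom_mul_inv (α := α) hμ)
    rw [PowerSeries.coeff_mul] at h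
    cases n with
    | zero =>
      simp only [Finset.Nat.antidiagonal_zero, Finset.sum_singleton, PowerSeries.coeff_zero_one] at h
      rw [PowerSeries.coeff_zero_eq_constantCoeff_apply, constantCoeff_relaxDenom] at h
      by_contra! hc
      have : (1 + μ) * relaxResolvent α μ 0 ≤ 0 :=
        mul_nonpos_of_nonneg_of_nonpos (by positivity) hc.le
      rw [relaxResolvent] at this
      linarith
    | succ n =>
      rw [Finset.Nat.sum_antidiagonal_succ, PowerSeries.coeff_one, if_neg (Nat.succ_ne_zero n),
        PowerSeries.coeff_zero_eq_constantCoeff_apply, constantCoeff_relaxDenom] at h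
      have h2 : ∑ p ∈ Finset.HasAntidiagonal.antidiagonal n, PowerSeries.coeff (p.1 + 1) (relaxDenom α μ) *
          PowerSeries.coeff p.2 (relaxDenom α μ)⁻¹ ≤ 0 := by
        refine Finset.sum_nonpos fun p hp => mul_nonpos_of_nonpos_of_nonneg ?_
          (ih p.2 (by have := Finset.HasAntidiagonal.mem_antidiagonal.1 hp; omega))
        rw [relaxDenom, map_add, negBinomSeries, PowerSeries.coeff_mk, PowerSeries.coeff_C,
          if_neg (Nat.succ_ne_zero _), add_zero]
        have h3 := negBinom_neg_succ α p.1
        have h4 := negBinom_nonneg (x := 1 - α) (by linarith) p.1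
        by_contra! hc
        have : 0 < ((p.1 : ℝ) + 1) * negBinom (-α) (p.1 + 1) := by positivity
        nlinarith
      by_contra! hc
      have : (1 + μ) * relaxResolvent α μ (n + 1) < 0 :=
        mul_neg_of_pos_of_neg (by positivity) hc
      rw [relaxResolvent] at this
      linarith

theorem relaxSeq_nonneg (hα : 0 < α) (hα1 : α ≤ 1) (hμ : 0 ≤ μ) (n : ℕ) :
    0 ≤ relaxSeq α μ n := by
  rw [relaxSeq, PowerSeries.coeff_mul]
  refine Finset.sum_nonneg fun p _ => mul_nonneg ?_ (relaxResolvent_nonneg hα hα1 hμ _)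
  rw [negBinomSeries, PowerSeries.coeff_mk]
  exact negBinom_nonneg (by linarith) _

/-- Since (1-z)(1-z)^(α-1) = (1-z)^α is the denominator minus μ, the successive drops of `relaxSeq`
are μ times the resolvent coefficients. -/
theorem one_sub_X_mul_relax (hμ : 0 ≤ μ) :
    (1 - PowerSeries.X) * (negBinomSeries (1 - α) * (relaxDenom α μ)⁻¹) =
      1 - PowerSeries.C μ * (relaxDenom α μ)⁻¹ := by
  rw [← negBinomSeries_neg_one, ← mul_assoc, ← negBinomSeries_add, show -1 + (1 - α) = -α by ring]
  have h : negBinomSeries (-α) = relaxDenom α μ - PowerSeries.C μ := by simp [relaxDenom]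
  rw [h, sub_mul, relaxDenom_mul_inv hμ]

theorem relaxSeq_zero (hμ : 0 ≤ μ) : relaxSeq α μ 0 = 1 - μ * relaxResolvent α μ 0 := by
  have h := congrArg (PowerSeries.coeff 0) (one_sub_X_mul_relax (α := α) hμ)
  rw [sub_mul, map_sub, map_sub, PowerSeries.coeff_C_mul, PowerSeries.coeff_zero_X_mul, one_mul,
    sub_zero, PowerSeries.coeff_zero_one] at h
  exact h

theorem relaxSeq_succ (hμ : 0 ≤ μ) (n : ℕ) :
    relaxSeq α μ (n + 1) = relaxSeq α μ n - μ * relaxResolvent α μ (n + 1) := by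
  have h := congrArg (PowerSeries.coeff (n + 1)) (one_sub_X_mul_relax (α := α) hμ)
  rw [sub_mul, map_sub, map_sub, PowerSeries.coeff_C_mul, PowerSeries.coeff_succ_X_mul, one_mul,
    PowerSeries.coeff_one, if_neg (Nat.succ_ne_zero n)] at h
  simp only [relaxSeq, relaxResolvent]
  linarith

theorem relaxSeq_eq_one_sub (hμ : 0 ≤ μ) (n : ℕ) :
    relaxSeq α μ n = 1 - ∑ j ∈ Finset.range (n + 1), μ * relaxResolvent α μ j := by
  induction n with
  | zero => simp [relaxSeq_zero hμ]
  | succ n ih => rw [relaxSeq_succ hμ, ih, Finset.sum_range_succ _ (n + 1)]; ring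

theorem relaxSeq_antitone (hα : 0 < α) (hα1 : α ≤ 1) (hμ : 0 ≤ μ) :
    Antitone (relaxSeq α μ) := by
  refine antitone_nat_of_succ_le fun n => ?_
  rw [relaxSeq_succ hμ]
  linarith [mul_nonneg hμ (relaxResolvent_nonneg hα hα1 hμ (n + 1))]

theorem relaxSeq_le_one (hα : 0 < α) (hα1 : α ≤ 1) (hμ : 0 ≤ μ) (n : ℕ) :
    relaxSeq α μ n ≤ 1 := by
  rw [relaxSeq_eq_one_sub hμ]
  linarith [Finset.sum_nonneg fun j (_ : j ∈ Finset.range (n + 1)) =>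
    mul_nonneg hμ (relaxResolvent_nonneg hα hα1 hμ j)]

theorem derivative_relaxDenom :
    PowerSeries.derivative ℝ (relaxDenom α μ) = PowerSeries.C (-α) * negBinomSeries (1 - α) := by
  ext n
  rw [PowerSeries.coeff_derivative, PowerSeries.coeff_C_mul, relaxDenom, map_add,
    PowerSeries.coeff_C, if_neg (Nat.succ_ne_zero n), negBinomSeries, negBinomSeries,
    PowerSeries.coeff_mk, PowerSeries.coeff_mk, add_zero, ← negBinom_neg_succ, mul_comm]

/-- With D the denominator, D' = -α (1-z)^(α-1), so (1/D)' = α · ((1-z)^(α-1)/D) · (1/D); compare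
coefficients. -/
theorem mul_relaxResolvent_succ (n : ℕ) :
    relaxResolvent α μ (n + 1) * (n + 1) =
      α * ∑ p ∈ Finset.HasAntidiagonal.antidiagonal n, relaxSeq α μ p.1 * relaxResolvent α μ p.2 := by
  have h : PowerSeries.derivative ℝ (relaxDenom α μ)⁻¹ = PowerSeries.C α *
      ((negBinomSeries (1 - α) * (relaxDenom α μ)⁻¹) * (relaxDenom α μ)⁻¹) := by
    rw [PowerSeries.derivative_inv', derivative_relaxDenom, map_neg]
    ring
  have h2 := congrArg (PowerSeries.coeff n) h
  rw [PowerSeries.coeff_derivative, PowerSeries.coeff_C_mul, PowerSeries.coeff_mul] at h2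
  exact h2

/-- Discrete version of |r'(t)| ≤ 1/t. Bounding `relaxSeq` by 1 in the convolution leaves α μ times
a partial sum of the resolvent, and μ times that sum is 1 minus a nonnegative term of `relaxSeq`. -/
theorem mul_relaxResolvent_le (hα : 0 < α) (hα1 : α ≤ 1) (hμ : 0 ≤ μ) (n : ℕ) :
    μ * relaxResolvent α μ (n + 1) ≤ 1 / (n + 1) := by
  rw [le_div_iff₀ (by positivity), mul_assoc, mul_relaxResolvent_succ]
  have h1 : ∑ p ∈ Finset.HasAntidiagonal.antidiagonal n, relaxSeq α μ p.1 * relaxResolvent α μ p.2 ≤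
      ∑ j ∈ Finset.range (n + 1), relaxResolvent α μ j := by
    rw [Finset.Nat.sum_antidiagonal_eq_sum_range_succ_mk, ← Finset.sum_range_reflect]
    refine Finset.sum_le_sum fun j hj => ?_
    have h := relaxSeq_le_one hα hα1 hμ (n + 1 - 1 - j)
    have hj' := Finset.mem_range.1 hj
    rw [show n - (n + 1 - 1 - j) = j by omega]
    exact mul_le_of_le_one_left (relaxResolvent_nonneg hα hα1 hμ _) h
  have h2 : μ * ∑ j ∈ Finset.range (n + 1), relaxResolvent α μ j ≤ 1 := by
    have := relaxSeq_eq_one_sub (α := α) hμ n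
    rw [← Finset.mul_sum] at this
    linarith [relaxSeq_nonneg hα hα1 hμ n]
  have h3 : 0 ≤ μ * ∑ j ∈ Finset.range (n + 1), relaxResolvent α μ j :=
    mul_nonneg hμ (Finset.sum_nonneg fun j _ => relaxResolvent_nonneg hα hα1 hμ j)
  nlinarith [mul_le_mul_of_nonneg_left h1 (mul_nonneg hμ hα.le)]

theorem relaxSeq_sub_le (hα : 0 < α) (hα1 : α ≤ 1) (hμ : 0 ≤ μ) {n : ℕ} (hn : 0 < n) (k : ℕ) :
    relaxSeq α μ n - relaxSeq α μ (n + k) ≤ k / n := by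
  induction k with
  | zero => simp
  | succ k ih =>
    rw [← add_assoc, relaxSeq_succ hμ]
    have h := mul_relaxResolvent_le hα hα1 hμ (n + k)
    have h2 : (1 : ℝ) / ((n + k : ℕ) + 1) ≤ 1 / n := by
      refine one_div_le_one_div_of_le (by positivity) ?_
      push_cast
      linarith [Nat.cast_nonneg (α := ℝ) k]
    push_cast
    rw [add_div]
    push_cast at h h2
    linarith

end Relaxation

/-! ### The Mittag-Leffler function as a limit of relaxation sequences -/

section Relaxation

variable {α μ : ℝ}

theorem summable_pow_mul_negBinom (hα : 0 < α) (hα1 : α ≤ 1) (hμ : 0 ≤ μ) (hμ1 : μ < 1) (n : ℕ) :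
    Summable fun k : ℕ => μ ^ k * negBinom (α * k + 1) n := by
  have h1 : Summable fun k : ℕ => ((2 + k : ℕ) : ℝ) ^ n * μ ^ (2 + k) := by
    have := summable_pow_mul_geometric_of_norm_lt_one (R := ℝ) n (r := μ)
      (by rwa [Real.norm_of_nonneg hμ])
    have h := (summable_nat_add_iff 2).2 this
    simpa [add_comm] using h
  -- The majorant is the shifted series ∑ (k+2)^n μ^(k+2), divided by μ²; hence μ = 0 is treated
  -- apart.
  rcases hμ.eq_or_lt with rfl | hμ0
  · exact summable_of_ne_finset_zero (s := {0}) fun k hk => by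
      simp only [Finset.mem_singleton] at hk
      simp [hk]
  have h2 := h1.mul_left (μ ^ 2)⁻¹
  refine Summable.of_nonneg_of_le (fun k => mul_nonneg (pow_nonneg hμ k)
    (negBinom_nonneg (by positivity) n)) (fun k => ?_) h2
  have h3 : negBinom (α * k + 1) n ≤ ((2 + k : ℕ) : ℝ) ^ n := by
    refine (negBinom_le (by positivity) n).trans (pow_le_pow_left₀ (by positivity) ?_ n)
    push_cast
    nlinarith [Nat.cast_nonneg (α := ℝ) k]
  rw [show (μ ^ 2)⁻¹ * (((2 + k : ℕ) : ℝ) ^ n * μ ^ (2 + k)) = μ ^ k * ((2 + k : ℕ) : ℝ) ^ n by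
    rw [pow_add]; field_simp]
  gcongr

/-- This is the geometric expansion (1-z)^(α-1) / ((1-z)^α + μ) = ∑ (-μ)^k (1-z)^(-αk-1), read off
at each power of z. -/
theorem relaxSeq_eq_tsum (hα : 0 < α) (hα1 : α ≤ 1) (hμ : 0 ≤ μ) (hμ1 : μ < 1) (n : ℕ) :
    relaxSeq α μ n = ∑' k : ℕ, (-μ) ^ k * negBinom (α * k + 1) n := by
  set a : ℕ → ℝ := fun n => ∑' k : ℕ, (-μ) ^ k * negBinom (α * k + 1) n with ha
  have hs : ∀ n, HasSum (fun k : ℕ => (-μ) ^ k * negBinom (α * k + 1) n) (a n) := by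
    intro n
    refine Summable.hasSum (Summable.of_norm ?_)
    refine (summable_pow_mul_negBinom hα hα1 hμ hμ1 n).congr fun k => ?_
    rw [norm_mul, norm_pow, norm_neg, Real.norm_of_nonneg hμ,
      Real.norm_of_nonneg (negBinom_nonneg (by positivity) n)]
  -- Multiplying by (1-z)^α lowers each exponent by α, which turns the k-th term into -μ times the
  -- term k-1. Adding μ times the series then cancels everything but k = 0.
  have hD : PowerSeries.mk a * relaxDenom α μ = negBinomSeries (1 - α) := by
    ext n
    rw [relaxDenom, mul_add, map_add, PowerSeries.coeff_mul_C, PowerSeries.coeff_mul,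
      PowerSeries.coeff_mk]
    simp only [negBinomSeries, PowerSeries.coeff_mk]
    have h1 : HasSum (fun k : ℕ => (-μ) ^ k * negBinom (α * k + 1 - α) n)
        (∑ p ∈ Finset.HasAntidiagonal.antidiagonal n, a p.1 * negBinom (-α) p.2) := by
      have := hasSum_sum (s := Finset.HasAntidiagonal.antidiagonal n)
        fun p _ => (hs p.1).mul_right (negBinom (-α) p.2)
      refine this.congr_fun ?_
      intro k
      rw [sub_eq_add_neg, negBinom_add, Finset.mul_sum]
      exact Finset.sum_congr rfl fun p _ => by ring
    have h2 : HasSum (fun k : ℕ => (-μ) ^ (k + 1) * negBinom (α * (k + 1 : ℕ) + 1 - α) n)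
        (-μ * a n) := by
      refine ((hs n).mul_left (-μ)).congr_fun fun k => ?_
      push_cast
      rw [show α * (k + 1) + 1 - α = α * k + 1 by ring, pow_succ]
      ring
    have h3 := ((hasSum_nat_add_iff (f := fun k : ℕ => (-μ) ^ k * negBinom (α * k + 1 - α) n) 1).1 h2).unique
      h1
    simp only [Finset.range_one, Finset.sum_singleton, pow_zero, Nat.cast_zero, mul_zero, zero_add,
      one_mul] at h3
    linarith
  have h : PowerSeries.mk a = negBinomSeries (1 - α) * (relaxDenom α μ)⁻¹ := by
    rw [← hD, mul_assoc, relaxDenom_mul_inv hμ, mul_one]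
  rw [relaxSeq, ← h, PowerSeries.coeff_mk]

end Relaxation

/-- The quotient equals n/(n+x+1) divided by Euler's sequence for Γ(x+1). -/
theorem tendsto_negBinom_div_rpow {x : ℝ} (hx : 0 ≤ x) :
    Tendsto (fun n : ℕ => negBinom (x + 1) n / (n : ℝ) ^ x) atTop (𝓝 (1 / Real.Gamma (x + 1))) := by
  have h1 := (Real.GammaSeq_tendsto_Gamma (x + 1)).inv₀ (Real.Gamma_pos_of_pos (by positivity)).ne'
  have h2 : Tendsto (fun n : ℕ => (n : ℝ) / (n + (x + 1))) atTop (𝓝 1) :=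
    tendsto_natCast_div_add_atTop _
  have h3 := h2.mul h1
  rw [one_mul, ← one_div] at h3
  refine h3.congr' ?_
  filter_upwards [eventually_gt_atTop 0] with n hn
  have hn' : (0 : ℝ) < n := by exact_mod_cast hn
  have h4 : negBinom (x + 1) n * n.factorial = ∏ j ∈ Finset.range n, (x + 1 + j) := by
    rw [negBinom, Finset.prod_div_distrib]
    have : (n.factorial : ℝ) = ∏ j ∈ Finset.range n, ((j : ℝ) + 1) := by
      rw [← Finset.prod_range_add_one_eq_factorial]; push_cast; rfl
    rw [this, div_mul_cancel₀]
    exact (Finset.prod_pos fun j _ => by positivity).ne'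
  rw [Real.GammaSeq, Finset.prod_range_succ, ← h4, Real.rpow_add_one hn'.ne']
  have h5 : (0 : ℝ) < n.factorial := by exact_mod_cast n.factorial_pos
  have h6 : (0 : ℝ) < (n : ℝ) ^ x := Real.rpow_pos_of_pos hn' _
  have h7 : 0 < (n : ℝ) + (x + 1) := by positivity
  have h8 : 0 < x + 1 + (n : ℝ) := by positivity
  field_simp
  ring

/-- The ratio of consecutive terms is (1 + x/(n+1)) (1 - 1/(n+1))^x, and the two factors are at most
exp(x/(n+1)) and exp(-x/(n+1)). Monotonicity in n supplies the majorant for the limit of `relaxSeq`.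
-/
theorem negBinom_div_rpow_succ_le {x : ℝ} (hx : 0 ≤ x) {n : ℕ} (hn : 0 < n) :
    negBinom (x + 1) (n + 1) / ((n + 1 : ℕ) : ℝ) ^ x ≤ negBinom (x + 1) n / (n : ℝ) ^ x := by
  have hn' : (0 : ℝ) < n := by exact_mod_cast hn
  have h0 : 0 ≤ negBinom (x + 1) n := negBinom_nonneg (by positivity) n
  have h6 : (0 : ℝ) < (n : ℝ) ^ x := Real.rpow_pos_of_pos hn' _
  have h7 : (0 : ℝ) < ((n + 1 : ℕ) : ℝ) ^ x := Real.rpow_pos_of_pos (by positivity) _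
  have key : (x + 1 + n) / (n + 1) * (n : ℝ) ^ x ≤ ((n + 1 : ℕ) : ℝ) ^ x := by
    have h8 : (x + 1 + n) / (n + 1) ≤ Real.exp (x / (n + 1)) := by
      have := Real.add_one_le_exp (x / ((n : ℝ) + 1))
      have h9 : (x + 1 + n) / ((n : ℝ) + 1) = x / (n + 1) + 1 := by field_simp; ring
      linarith
    have h9 : Real.exp (1 / ((n : ℝ) + 1)) * n ≤ n + 1 := by
      have := Real.one_sub_le_exp_neg (1 / ((n : ℝ) + 1))
      rw [Real.exp_neg] at this
      have hpos := Real.exp_pos (1 / ((n : ℝ) + 1))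
      have h10 : 1 - 1 / ((n : ℝ) + 1) = n / (n + 1) := by field_simp; ring
      rw [h10, div_le_iff₀ (by positivity)] at this
      have := mul_le_mul_of_nonneg_left this hpos.le
      rwa [← mul_assoc, mul_inv_cancel₀ hpos.ne', one_mul] at this
    calc (x + 1 + n) / (n + 1) * (n : ℝ) ^ x
        ≤ Real.exp (x / (n + 1)) * (n : ℝ) ^ x := by gcongr
      _ = (Real.exp (1 / ((n : ℝ) + 1)) * n) ^ x := by
          rw [Real.mul_rpow (Real.exp_pos _).le hn'.le, ← Real.exp_mul]
          congr 2
          ring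
      _ ≤ ((n + 1 : ℕ) : ℝ) ^ x := by
          push_cast
          exact Real.rpow_le_rpow (by positivity) h9 hx
  rw [negBinom_succ, div_le_div_iff₀ h7 h6, mul_assoc]
  exact mul_le_mul_of_nonneg_left key h0

theorem negBinom_div_rpow_le {x : ℝ} (hx : 0 ≤ x) {m n : ℕ} (hm : 0 < m) (hmn : m ≤ n) :
    negBinom (x + 1) n / (n : ℝ) ^ x ≤ negBinom (x + 1) m / (m : ℝ) ^ x := by
  induction n, hmn using Nat.le_induction with
  | base => exact le_rfl
  | succ n hmn ih => exact (negBinom_div_rpow_succ_le hx (by omega)).trans ih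

theorem tendsto_relaxSeq {α : ℝ} (hα : 0 < α) (hα1 : α ≤ 1) {y : ℝ}
    {μ : ℕ → ℝ} {n : ℕ → ℕ} (hμ : ∀ N, 0 ≤ μ N) (hn : Tendsto n atTop atTop)
    (h : Tendsto (fun N => μ N * (n N : ℝ) ^ α) atTop (𝓝 y)) :
    Tendsto (fun N => relaxSeq α (μ N) (n N)) atTop (𝓝 (mittagLeffler α (-y))) := by
  have hy : 0 ≤ y := ge_of_tendsto' h fun N => mul_nonneg (hμ N) (by positivity)
  -- Eventually μ n^α ≤ y + 1 and n ≥ m. Replacing n by the fixed m in the normalized coefficients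
  -- gives the majorant q^k `negBinom (α * k + 1) m`, and this choice of m makes q ≤ 1/2. The same m
  -- yields μ < 1 below, where the expansion is needed.
  obtain ⟨m, hm0, hm⟩ : ∃ m : ℕ, 0 < m ∧ 2 * (y + 1) ≤ (m : ℝ) ^ α := by
    have := ((tendsto_rpow_atTop hα).comp tendsto_natCast_atTop_atTop).eventually_ge_atTop
      (2 * (y + 1))
    obtain ⟨m, h1, h2⟩ := (this.and (eventually_gt_atTop 0)).exists
    exact ⟨m, h2, h1⟩
  set q : ℝ := (y + 1) / (m : ℝ) ^ α with hq
  have hmpos : 0 < (m : ℝ) ^ α := Real.rpow_pos_of_pos (by exact_mod_cast hm0) _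
  have hq0 : 0 ≤ q := by positivity
  have hq1 : q < 1 := by
    rw [hq, div_lt_one hmpos]; linarith
  have hev : ∀ᶠ N in atTop, μ N * (n N : ℝ) ^ α ≤ y + 1 ∧ m ≤ n N :=
    (h.eventually (ge_mem_nhds (by linarith))).and (hn.eventually_ge_atTop m)
  have hpow : ∀ (j k : ℕ), (j : ℝ) ^ (α * k) = ((j : ℝ) ^ α) ^ k := fun j k => by
    rw [Real.rpow_mul (Nat.cast_nonneg j), Real.rpow_natCast]
  have hlim : Tendsto (fun N => ∑' k : ℕ, (-(μ N * (n N : ℝ) ^ α)) ^ k *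
      (negBinom (α * k + 1) (n N) / (n N : ℝ) ^ (α * k))) atTop (𝓝 (mittagLeffler α (-y))) := by
    refine tendsto_tsum_of_dominated_convergence
      (summable_pow_mul_negBinom hα hα1 hq0 hq1 m) (fun k => ?_) ?_
    · have h1 := (tendsto_negBinom_div_rpow (x := α * k) (by positivity)).comp hn
      have h2 := (h.neg.pow k).mul h1
      rw [mul_one_div] at h2
      exact h2
    · filter_upwards [hev] with N hN k
      have hg := negBinom_div_rpow_le (x := α * k) (by positivity) hm0 hN.2
      have hg0 : 0 ≤ negBinom (α * k + 1) (n N) / (n N : ℝ) ^ (α * k) :=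
        div_nonneg (negBinom_nonneg (by positivity) _) (by positivity)
      have h0 : 0 ≤ μ N * (n N : ℝ) ^ α := mul_nonneg (hμ N) (by positivity)
      rw [norm_mul, norm_pow, norm_neg, Real.norm_of_nonneg h0, Real.norm_of_nonneg hg0]
      calc (μ N * (n N : ℝ) ^ α) ^ k * (negBinom (α * k + 1) (n N) / (n N : ℝ) ^ (α * k))
          ≤ (y + 1) ^ k * (negBinom (α * k + 1) m / (m : ℝ) ^ (α * k)) := by
            gcongr
            exact hN.1
        _ = q ^ k * negBinom (α * k + 1) m := by
            rw [hpow, hq, div_pow]; ring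
  refine hlim.congr' ?_
  filter_upwards [hev] with N hN
  have hnN : 0 < (n N : ℝ) := by exact_mod_cast lt_of_lt_of_le hm0 hN.2
  have hnpos : 0 < (n N : ℝ) ^ α := Real.rpow_pos_of_pos hnN _
  have hμ1 : μ N < 1 := by
    have h1 : (m : ℝ) ^ α ≤ (n N : ℝ) ^ α :=
      Real.rpow_le_rpow (by positivity) (by exact_mod_cast hN.2) hα.le
    nlinarith [hN.1]
  rw [relaxSeq_eq_tsum hα hα1 (hμ N) hμ1]
  refine tsum_congr fun k => ?_
  rw [hpow, ← neg_mul, mul_pow]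
  field_simp

/-! ### Temporal relaxation -/

/-- The relaxation function `t ↦ E_α(-λ t^α)`. -/
def relaxation (α lam t : ℝ) : ℝ := mittagLeffler α (-lam * t ^ α)

section

variable {α lam : ℝ}

theorem relaxation_zero (hα : 0 < α) : relaxation α lam 0 = 1 := by
  rw [relaxation, Real.zero_rpow hα.ne', mul_zero, mittagLeffler, tsum_eq_single 0]
  · simp
  · intro k hk
    simp [hk]

theorem tendsto_floor_mul_atTop {t : ℝ} (ht : 0 < t) :
    Tendsto (fun N : ℕ => ⌊t * N⌋₊) atTop atTop :=
  tendsto_nat_floor_atTop.comp (tendsto_natCast_atTop_atTop.const_mul_atTop ht)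

/-- A time grid of width 1/N: the scheme has parameter λ N^(-α), and time t corresponds to step
⌊tN⌋. -/
theorem tendsto_relaxation (hα : 0 < α) (hα1 : α ≤ 1) (hl : 0 ≤ lam) {t : ℝ} (ht : 0 < t) :
    Tendsto (fun N : ℕ => relaxSeq α (lam * ((N : ℝ) ^ α)⁻¹) ⌊t * N⌋₊) atTop
      (𝓝 (relaxation α lam t)) := by
  rw [relaxation, neg_mul]
  refine tendsto_relaxSeq hα hα1 (fun N => by positivity) (tendsto_floor_mul_atTop ht) ?_
  have h1 : Tendsto (fun N : ℕ => (⌊t * N⌋₊ : ℝ) / N) atTop (𝓝 t) :=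
    (tendsto_nat_floor_mul_div_atTop ht.le).comp tendsto_natCast_atTop_atTop
  have h2 := (h1.rpow_const (Or.inr hα.le) (p := α)).const_mul lam
  refine h2.congr fun N => ?_
  rw [Real.div_rpow (Nat.cast_nonneg _) (Nat.cast_nonneg _), mul_assoc, div_eq_inv_mul]

theorem relaxation_nonneg (hα : 0 < α) (hα1 : α ≤ 1) (hl : 0 ≤ lam) {t : ℝ} (ht : 0 ≤ t) :
    0 ≤ relaxation α lam t := by
  rcases ht.eq_or_lt with rfl | ht
  · rw [relaxation_zero hα]; exact zero_le_one
  · exact ge_of_tendsto' (tendsto_relaxation hα hα1 hl ht) fun N =>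
      relaxSeq_nonneg hα hα1 (by positivity) _

theorem relaxation_le_one (hα : 0 < α) (hα1 : α ≤ 1) (hl : 0 ≤ lam) {t : ℝ} (ht : 0 ≤ t) :
    relaxation α lam t ≤ 1 := by
  rcases ht.eq_or_lt with rfl | ht
  · rw [relaxation_zero hα]
  · exact le_of_tendsto' (tendsto_relaxation hα hα1 hl ht) fun N =>
      relaxSeq_le_one hα hα1 (by positivity) _

theorem relaxation_antitoneOn (hα : 0 < α) (hα1 : α ≤ 1) (hl : 0 ≤ lam) :
    AntitoneOn (relaxation α lam) (Set.Ici 0) := by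
  intro s hs t ht hst
  rcases (Set.mem_Ici.1 hs).eq_or_lt with rfl | hs
  · rw [relaxation_zero hα]; exact relaxation_le_one hα hα1 hl ht
  · refine le_of_tendsto_of_tendsto' (tendsto_relaxation hα hα1 hl (hs.trans_le hst))
      (tendsto_relaxation hα hα1 hl hs) fun N => ?_
    exact relaxSeq_antitone hα hα1 (by positivity) (Nat.floor_le_floor (by gcongr))

theorem relaxation_sub_le (hα : 0 < α) (hα1 : α ≤ 1) (hl : 0 ≤ lam) {t h : ℝ} (ht : 0 < t)
    (hh : 0 ≤ h) : relaxation α lam t - relaxation α lam (t + h) ≤ h / t := by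
  have hfl : ∀ {t : ℝ}, 0 ≤ t → Tendsto (fun N : ℕ => (⌊t * N⌋₊ : ℝ) / N) atTop (𝓝 t) :=
    fun ht => (tendsto_nat_floor_mul_div_atTop ht).comp tendsto_natCast_atTop_atTop
  have h1 := ((hfl (by positivity : 0 ≤ t + h)).sub (hfl ht.le)).div (hfl ht.le) ht.ne'
  rw [add_sub_cancel_left] at h1
  refine le_of_tendsto_of_tendsto ((tendsto_relaxation hα hα1 hl ht).sub
    (tendsto_relaxation hα hα1 hl (by positivity))) h1 ?_
  filter_upwards [(tendsto_floor_mul_atTop ht).eventually_gt_atTop 0, eventually_gt_atTop 0]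
    with N hN hN0
  have hle : ⌊t * N⌋₊ ≤ ⌊(t + h) * N⌋₊ := Nat.floor_le_floor (by gcongr; linarith)
  obtain ⟨k, hk⟩ := Nat.exists_eq_add_of_le hle
  rw [hk]
  refine (relaxSeq_sub_le hα hα1 (by positivity) hN k).trans (le_of_eq ?_)
  have : (0 : ℝ) < N := by exact_mod_cast hN0
  have h2 : (0 : ℝ) < ⌊t * N⌋₊ := by exact_mod_cast hN
  simp only [Pi.div_apply]
  rw [hk]
  push_cast
  field_simp
  ring

end

/-! ### Orthogonality of the associated Legendre functions -/

section Legendre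

open Polynomial

/-- The integral of a polynomial over `[-1, 1]`. -/
def polyIntegral (p : ℝ[X]) : ℝ := ∫ x in (-1 : ℝ)..1, p.eval x

theorem intervalIntegrable_eval (p : ℝ[X]) (a b : ℝ) :
    IntervalIntegrable (fun x => p.eval x) volume a b :=
  p.continuous.intervalIntegrable a b

theorem polyIntegral_add (p q : ℝ[X]) : polyIntegral (p + q) = polyIntegral p + polyIntegral q := by
  simp only [polyIntegral, eval_add]
  exact intervalIntegral.integral_add (intervalIntegrable_eval p _ _) (intervalIntegrable_eval q _ _)

theorem polyIntegral_C_mul (c : ℝ) (p : ℝ[X]) : polyIntegral (C c * p) = c * polyIntegral p := by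
  simp [polyIntegral]

theorem polyIntegral_derivative (p : ℝ[X]) :
    polyIntegral (derivative p) = p.eval 1 - p.eval (-1) :=
  intervalIntegral.integral_eq_sub_of_hasDerivAt (fun x _ => p.hasDerivAt x)
    (intervalIntegrable_eval _ _ _)

theorem polyIntegral_derivative_mul {u v : ℝ[X]} (h1 : (u * v).eval 1 = 0)
    (h2 : (u * v).eval (-1) = 0) :
    polyIntegral (derivative u * v) = -polyIntegral (u * derivative v) := by
  have h := polyIntegral_derivative (u * v)
  rw [derivative_mul, polyIntegral_add, h1, h2] at h
  linarith

/-- The products in `hb` are exactly the boundary terms of the successive integrations by parts;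
divisibility by X² - 1 makes them vanish at ±1. -/
theorem polyIntegral_iterate_derivative_mul {w v : ℝ[X]} {N : ℕ}
    (hb : ∀ j < N, ((X ^ 2 - 1 : ℝ[X]) ∣ derivative^[N - 1 - j] w * derivative^[j] v))
    {i : ℕ} (hi : i ≤ N) :
    polyIntegral (derivative^[N] w * v) =
      (-1) ^ i * polyIntegral (derivative^[N - i] w * derivative^[i] v) := by
  induction i with
  | zero => simp
  | succ i ih =>
    obtain ⟨r, hr⟩ := hb i (by omega)
    rw [ih (by omega), show N - i = (N - 1 - i) + 1 by omega, Function.iterate_succ_apply',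
      polyIntegral_derivative_mul (by rw [hr]; simp) (by rw [hr]; simp),
      show N - (i + 1) = N - 1 - i by omega, ← Function.iterate_succ_apply' derivative i v]
    ring

/-- Integrating the derivative of X (1-X²)^(l+1), which vanishes at both ends, gives (2l+3) I_(l+1)
= 2(l+1) I_l. -/
theorem polyIntegral_one_sub_sq_pow (l : ℕ) :
    polyIntegral ((1 - X ^ 2) ^ l) * ((2 * l + 1).factorial : ℝ) =
      2 ^ (2 * l + 1) * (l.factorial : ℝ) ^ 2 := by
  induction l with
  | zero => simp [polyIntegral]; norm_num
  | succ l ih =>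
    have h1 : derivative (X * (1 - X ^ 2 : ℝ[X]) ^ (l + 1)) =
        C (2 * (l : ℝ) + 3) * (1 - X ^ 2) ^ (l + 1) +
          C (-(2 * ((l : ℝ) + 1))) * (1 - X ^ 2) ^ l := by
      rw [derivative_mul, derivative_X, derivative_pow]
      simp only [derivative_sub, derivative_one, derivative_X_pow, map_add, map_mul, map_neg,
        map_natCast, map_one, Nat.cast_add, Nat.cast_one, Nat.add_sub_cancel, map_ofNat]
      push_cast
      ring
    have h2 := polyIntegral_derivative (X * (1 - X ^ 2 : ℝ[X]) ^ (l + 1))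
    rw [h1, polyIntegral_add, polyIntegral_C_mul, polyIntegral_C_mul] at h2
    simp only [eval_mul, eval_X, eval_pow, eval_sub, eval_one, one_pow, sub_self, ne_eq,
      Nat.add_eq_zero_iff, one_ne_zero, and_false, not_false_eq_true, zero_pow, mul_zero,
      even_two, Even.neg_pow] at h2
    rw [show 2 * (l + 1) + 1 = (2 * l + 1) + 1 + 1 by ring, Nat.factorial_succ,
      Nat.factorial_succ (2 * l + 1), Nat.factorial_succ l]
    push_cast
    linear_combination (2 * (l : ℝ) + 2) * ((2 * l + 1).factorial : ℝ) * h2 +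
      4 * ((l : ℝ) + 1) ^ 2 * ih

theorem natDegree_sq_sub_one_pow_le (l : ℕ) : ((X ^ 2 - 1 : ℝ[X]) ^ l).natDegree ≤ l * 2 :=
  natDegree_pow_le_of_le l (by compute_degree)

theorem natDegree_one_sub_sq_pow_le (l : ℕ) : ((1 - X ^ 2 : ℝ[X]) ^ l).natDegree ≤ l * 2 :=
  natDegree_pow_le_of_le l (by compute_degree)

theorem iterate_derivative_legendre (l m : ℕ) :
    derivative^[m] (legendre l) =
      C (((2 : ℝ) ^ l * (l.factorial : ℝ))⁻¹) * derivative^[l + m] ((X ^ 2 - 1) ^ l) := by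
  rw [legendre, iterate_derivative_C_mul, ← Function.iterate_add_apply, add_comm]

theorem natDegree_legendre_le (l : ℕ) : (legendre l).natDegree ≤ l := by
  refine (natDegree_C_mul_le _ _).trans ((natDegree_iterate_derivative _ _).trans ?_)
  have := natDegree_sq_sub_one_pow_le l
  omega

theorem coeff_legendre (l : ℕ) :
    (legendre l).coeff l = ((2 : ℝ) ^ l * (l.factorial : ℝ))⁻¹ * (2 * l).descFactorial l := by
  rw [legendre, coeff_C_mul, coeff_iterate_derivative, ← two_mul]
  have h : ((X ^ 2 - 1 : ℝ[X]) ^ l).coeff (l * 2) = ((X ^ 2 - 1 : ℝ[X]).coeff 2) ^ l :=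
    coeff_pow_of_natDegree_le (by compute_degree)
  rw [mul_comm l 2] at h
  rw [h]
  simp [coeff_one]

/-- `(1 - X ^ 2) ^ m` times the `m`-th derivative of the Legendre polynomial. -/
def weightedLegendre (l m : ℕ) : ℝ[X] := (1 - X ^ 2) ^ m * derivative^[m] (legendre l)

theorem natDegree_weightedLegendre_le {l m : ℕ} (h : m ≤ l) :
    (weightedLegendre l m).natDegree ≤ l + m := by
  refine natDegree_mul_le.trans ?_
  have h1 := natDegree_one_sub_sq_pow_le m
  have h2 := (natDegree_iterate_derivative (legendre l) m).trans
    (Nat.sub_le_sub_right (natDegree_legendre_le l) m)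
  omega

theorem coeff_weightedLegendre {l m : ℕ} (h : m ≤ l) :
    (weightedLegendre l m).coeff (l + m) =
      (-1) ^ m * (l.descFactorial m * (((2 : ℝ) ^ l * (l.factorial : ℝ))⁻¹ *
        (2 * l).descFactorial l)) := by
  have h2 := (natDegree_iterate_derivative (legendre l) m).trans
    (Nat.sub_le_sub_right (natDegree_legendre_le l) m)
  rw [weightedLegendre, show l + m = m * 2 + (l - m) by omega,
    coeff_mul_add_eq_of_natDegree_le (natDegree_one_sub_sq_pow_le m) h2,
    coeff_pow_of_natDegree_le (by compute_degree), coeff_iterate_derivative,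
    show l - m + m = l by omega, coeff_legendre]
  simp [coeff_one]

theorem polyIntegral_legendre_by_parts (l k m : ℕ) :
    polyIntegral (derivative^[l + m] ((X ^ 2 - 1) ^ l) * weightedLegendre k m) =
      (-1) ^ (l + m) *
        polyIntegral ((X ^ 2 - 1) ^ l * derivative^[l + m] (weightedLegendre k m)) := by
  have h := polyIntegral_iterate_derivative_mul (w := (X ^ 2 - 1 : ℝ[X]) ^ l)
    (v := weightedLegendre k m) (N := l + m) ?_ le_rfl
  · simpa using h
  · intro j hj
    -- For j < m, fewer than m derivatives fall on the factor (1-X²)^m; for j ≥ m, at most l - 1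
    -- fall on (X²-1)^l. Either way one factor X² - 1 survives.
    rcases lt_or_ge j m with hjm | hjm
    · refine Dvd.dvd.mul_left ?_ _
      have h1 : (1 - X ^ 2 : ℝ[X]) ^ m ∣ weightedLegendre k m := dvd_mul_right _ _
      have h2 := pow_sub_dvd_iterate_derivative_of_pow_dvd j h1
      have h3 : (X ^ 2 - 1 : ℝ[X]) ∣ (1 - X ^ 2) := ⟨-1, by ring⟩
      exact (h3.trans (dvd_pow_self _ (by omega))).trans h2
    · refine Dvd.dvd.mul_right ?_ _
      have h2 := pow_sub_dvd_iterate_derivative_of_pow_dvd (l + m - 1 - j)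
        (dvd_refl ((X ^ 2 - 1 : ℝ[X]) ^ l))
      exact (dvd_pow_self _ (by omega)).trans h2

/-- After l + m integrations by parts, the derivative falls on a polynomial of degree at most k + m
< l + m. -/
theorem polyIntegral_legendre_mul_of_lt {l k m : ℕ} (hk : m ≤ k) (hkl : k < l) :
    polyIntegral (derivative^[m] (legendre l) * weightedLegendre k m) = 0 := by
  rw [iterate_derivative_legendre, mul_assoc, polyIntegral_C_mul, polyIntegral_legendre_by_parts,
    iterate_derivative_eq_zero (lt_of_le_of_lt (natDegree_weightedLegendre_le hk) (by omega))]
  simp [polyIntegral]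

/-- Here l + m derivatives leave only (l+m)! times the coefficient of X^(l+m), so the integral
reduces to that of (1-X²)^l; the rest is factorial arithmetic. -/
theorem polyIntegral_legendre_mul_self {l m : ℕ} (hm : m ≤ l) :
    polyIntegral (derivative^[m] (legendre l) * weightedLegendre l m) =
      2 / (2 * l + 1) * (((l + m).factorial : ℝ) / ((l - m).factorial : ℝ)) := by
  have hc : derivative^[l + m] (weightedLegendre l m) =
      C (((l + m).factorial : ℝ) * (weightedLegendre l m).coeff (l + m)) := by
    rw [eq_C_of_natDegree_le_zero (p := derivative^[l + m] (weightedLegendre l m))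
      ((natDegree_iterate_derivative _ _).trans (by
        have := natDegree_weightedLegendre_le hm
        omega)), coeff_iterate_derivative]
    simp [Nat.descFactorial_self]
  have hw : (X ^ 2 - 1 : ℝ[X]) ^ l = C ((-1) ^ l) * (1 - X ^ 2) ^ l := by
    rw [C_pow, ← mul_pow]
    congr 1
    simp
  rw [iterate_derivative_legendre, mul_assoc, polyIntegral_C_mul, polyIntegral_legendre_by_parts,
    hc, mul_comm ((X ^ 2 - 1 : ℝ[X]) ^ l), polyIntegral_C_mul, hw, polyIntegral_C_mul,
    coeff_weightedLegendre hm]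
  have h1 := polyIntegral_one_sub_sq_pow l
  have h2 : ((l - m).factorial : ℝ) * (l.descFactorial m : ℝ) = l.factorial := by
    exact_mod_cast Nat.factorial_mul_descFactorial hm
  have h3 : (l.factorial : ℝ) * ((2 * l).descFactorial l : ℝ) = (2 * l).factorial := by
    have := Nat.factorial_mul_descFactorial (show l ≤ 2 * l by omega)
    rw [show 2 * l - l = l by omega] at this
    exact_mod_cast this
  have h4 : ((2 * l + 1).factorial : ℝ) = (2 * l + 1) * (2 * l).factorial := by
    rw [Nat.factorial_succ]; push_cast; ring
  have p1 : ((l - m).factorial : ℝ) ≠ 0 := by positivity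
  have p2 : (l.factorial : ℝ) ≠ 0 := by positivity
  have p3 : ((2 * l).factorial : ℝ) ≠ 0 := by positivity
  have p4 : (2 * (l : ℝ) + 1) ≠ 0 := by positivity
  have e1 : (l.descFactorial m : ℝ) = l.factorial / (l - m).factorial := by
    rw [eq_div_iff p1, mul_comm, h2]
  have e2 : ((2 * l).descFactorial l : ℝ) = (2 * l).factorial / l.factorial := by
    rw [eq_div_iff p2, mul_comm, h3]
  have e3 : polyIntegral ((1 - X ^ 2) ^ l) =
      2 ^ (2 * l + 1) * (l.factorial : ℝ) ^ 2 / ((2 * l + 1) * (2 * l).factorial) := by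
    rw [← h4, eq_div_iff (by positivity), h1]
  have e4 : ((-1 : ℝ) ^ l) * (-1) ^ l = 1 := by rw [← mul_pow]; simp
  have e5 : ((-1 : ℝ) ^ m) * (-1) ^ m = 1 := by rw [← mul_pow]; simp
  rw [e1, e2, e3, pow_add (-1 : ℝ)]
  field_simp
  rw [pow_add, pow_mul]
  ring_nf
  rw [pow_mul, pow_mul (-1 : ℝ)]
  simp only [sq, e4, e5]
  rw [mul_comm l 2, pow_mul]
  norm_num

theorem polyIntegral_legendre_mul {l k m : ℕ} (hl : m ≤ l) (hk : m ≤ k) :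
    polyIntegral (derivative^[m] (legendre l) * weightedLegendre k m) =
      if l = k then 2 / (2 * l + 1) * (((l + m).factorial : ℝ) / ((l - m).factorial : ℝ))
      else 0 := by
  rcases lt_trichotomy k l with h | h | h
  · rw [if_neg h.ne', polyIntegral_legendre_mul_of_lt hk h]
  · subst h
    rw [if_pos rfl, polyIntegral_legendre_mul_self hk]
  -- The weight (1-X²)^m may be attached to either factor, so the roles of l and k can be exchanged.
  · rw [if_neg h.ne, weightedLegendre, mul_left_comm, mul_comm (derivative^[m] (legendre l)),
      ← mul_assoc, mul_comm _ (derivative^[m] (legendre k)), mul_assoc]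
    exact polyIntegral_legendre_mul_of_lt hl h

end Legendre

/-! ### Invariance of the surface measure -/

section Sphere

open scoped Pointwise

/-- The action of a linear isometry on the unit sphere. -/
def sphereMap (e : E3 ≃ₗᵢ[ℝ] E3) (x : S2) : S2 :=
  ⟨e x, by rw [mem_sphere_zero_iff_norm, e.norm_map]; exact norm_eq_of_mem_sphere x⟩

theorem continuous_sphereMap (e : E3 ≃ₗᵢ[ℝ] E3) : Continuous (sphereMap e) :=
  (e.continuous.comp continuous_subtype_val).subtype_mk _

/-- The surface measure of a set is a multiple of the Lebesgue measure of the cone over it, and a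
linear isometry carries cones to cones. -/
theorem measurePreserving_sphereMap (e : E3 ≃ₗᵢ[ℝ] E3) :
    MeasurePreserving (sphereMap e) sphereMeasure sphereMeasure := by
  refine ⟨(continuous_sphereMap e).measurable, ?_⟩
  have h : (volume : Measure E3).toSphere.map (sphereMap e) = (volume : Measure E3).toSphere := by
    ext s hs
    rw [Measure.map_apply (continuous_sphereMap e).measurable hs, Measure.toSphere_apply' _ hs,
      Measure.toSphere_apply' _ ((continuous_sphereMap e).measurable hs)]
    congr 1
    have : Set.Ioo (0 : ℝ) 1 • ((fun x : S2 => (x : E3)) '' (sphereMap e ⁻¹' s)) =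
        e ⁻¹' (Set.Ioo (0 : ℝ) 1 • ((fun x : S2 => (x : E3)) '' s)) := by
      ext y
      simp only [Set.mem_smul, Set.mem_preimage, Set.mem_image]
      constructor
      · rintro ⟨r, hr, _, ⟨x, hx, rfl⟩, rfl⟩
        exact ⟨r, hr, _, ⟨_, hx, rfl⟩, by simp [sphereMap]⟩
      · rintro ⟨r, hr, _, ⟨x, hx, rfl⟩, hy⟩
        refine ⟨r, hr, _, ⟨sphereMap e.symm x, ?_, rfl⟩, ?_⟩
        · have : sphereMap e (sphereMap e.symm x) = x := Subtype.ext (by simp [sphereMap])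
          rwa [this]
        · apply e.injective
          rw [← hy]
          simp [sphereMap]
    rw [this]
    exact e.measurePreserving.measure_preimage_emb e.toHomeomorph.measurableEmbedding _
  rw [sphereMeasure, Measure.map_smul, h]

theorem integral_comp_sphereMap {F : Type*} [NormedAddCommGroup F] [NormedSpace ℝ F]
    (e : E3 ≃ₗᵢ[ℝ] E3) {f : S2 → F} (hf : Continuous f) :
    ∫ x, f (sphereMap e x) ∂sphereMeasure = ∫ x, f x ∂sphereMeasure := by
  rw [← integral_map (measurePreserving_sphereMap e).aemeasurable
    hf.aestronglyMeasurable, (measurePreserving_sphereMap e).map_eq]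

theorem integrable_of_continuous {F : Type*} [NormedAddCommGroup F] {f : S2 → F}
    (hf : Continuous f) : Integrable f sphereMeasure :=
  hf.integrable_of_hasCompactSupport (HasCompactSupport.of_compactSpace f)

theorem continuous_coord (i : Fin 3) : Continuous fun x : S2 => (x : E3) i :=
  (EuclideanSpace.proj (𝕜 := ℝ) i).continuous.comp continuous_subtype_val

/-! ### Moments of the height function -/

theorem integral_rpow_exp_neg_sq (k : ℕ) :
    ∫ r in Set.Ioi (0 : ℝ), r ^ k * Real.exp (-r ^ 2) = 1 / 2 * Real.Gamma (((k : ℝ) + 1) / 2) := by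
  have h := integral_rpow_mul_exp_neg_rpow (p := 2) (q := k) (by norm_num)
    (by linarith [Nat.cast_nonneg (α := ℝ) k])
  rw [← h]
  refine setIntegral_congr_fun measurableSet_Ioi fun x _ => ?_
  simp only [Real.rpow_natCast, Real.rpow_ofNat]

theorem integral_even_pow_exp_neg_sq {k : ℕ} (hk : Even k) :
    ∫ r : ℝ, r ^ k * Real.exp (-r ^ 2) = Real.Gamma (((k : ℝ) + 1) / 2) := by
  have h := integral_comp_abs (f := fun r : ℝ => r ^ k * Real.exp (-r ^ 2))
  simp only [sq_abs, hk.pow_abs] at h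
  rw [h, integral_rpow_exp_neg_sq]
  ring

theorem integral_E3_pow_exp_neg_sq {k : ℕ} (hk : Even k) :
    ∫ x : E3, x 2 ^ k * Real.exp (-‖x‖ ^ 2) =
      Real.Gamma (1 / 2) ^ 2 * Real.Gamma (((k : ℝ) + 1) / 2) := by
  have h1 := (EuclideanSpace.volume_preserving_symm_measurableEquiv_toLp (Fin 3)).integral_comp
    (MeasurableEquiv.measurableEmbedding _)
    (fun y : Fin 3 → ℝ => ∏ i, (y i ^ (if i = 2 then k else 0) * Real.exp (-(y i) ^ 2)))
  rw [integral_fintype_prod_volume_eq_prod (fun (i : Fin 3) (y : ℝ) =>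
    y ^ (if i = 2 then k else 0) * Real.exp (-y ^ 2))] at h1
  rw [Fin.prod_univ_three] at h1
  have h0 := integral_even_pow_exp_neg_sq (k := 0) (by simp)
  have hkk := integral_even_pow_exp_neg_sq hk
  simp only [Nat.cast_zero, zero_add] at h0
  rw [if_neg (by decide), if_neg (by decide), if_pos rfl, h0, hkk, ← sq] at h1
  rw [← h1]
  refine integral_congr_ae (Eventually.of_forall fun x => ?_)
  simp only [Fin.prod_univ_three]
  rw [if_neg (by decide), if_neg (by decide), if_pos trivial, EuclideanSpace.norm_sq_eq,
    Fin.sum_univ_three]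
  simp only [Real.norm_eq_abs, sq_abs, neg_add, Real.exp_add, pow_zero, one_mul]
  simp only [MeasurableEquiv.toLp_symm_apply]
  ring

/-- Polar coordinates for the Gaussian integral that `integral_E3_pow_exp_neg_sq` evaluates as a
product. Comparing the two values isolates the moment on the sphere. -/
theorem integral_toSphere_pow_mul (k : ℕ) :
    ∫ x : E3, x 2 ^ k * Real.exp (-‖x‖ ^ 2) =
      (∫ x : S2, (x : E3) 2 ^ k ∂(volume : Measure E3).toSphere) *
        (1 / 2 * Real.Gamma ((((k + 2 : ℕ) : ℝ) + 1) / 2)) := by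
  have hd : Module.finrank ℝ E3 - 1 = 2 := by simp
  calc ∫ x : E3, x 2 ^ k * Real.exp (-‖x‖ ^ 2)
      = ∫ x : ({(0)}ᶜ : Set E3), (x : E3) 2 ^ k * Real.exp (-‖(x : E3)‖ ^ 2)
          ∂((volume : Measure E3).comap (↑)) := by
        rw [integral_subtype_comap (measurableSet_singleton _).compl
          fun x : E3 => x 2 ^ k * Real.exp (-‖x‖ ^ 2), restrict_compl_singleton]
    _ = ∫ z : S2 × Set.Ioi (0 : ℝ), (z.1 : E3) 2 ^ k *
          ((z.2 : ℝ) ^ k * Real.exp (-(z.2 : ℝ) ^ 2))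
          ∂(volume : Measure E3).toSphere.prod (.volumeIoiPow (Module.finrank ℝ E3 - 1)) := by
        rw [← (volume : Measure E3).measurePreserving_homeomorphUnitSphereProd.integral_comp
          (Homeomorph.measurableEmbedding _)]
        refine integral_congr_ae (Eventually.of_forall fun x => ?_)
        have hx : ‖(x : E3)‖ ≠ 0 := norm_ne_zero_iff.2 x.2
        simp only [homeomorphUnitSphereProd_apply_fst_coe, homeomorphUnitSphereProd_apply_snd_coe,
          PiLp.smul_apply, smul_eq_mul]
        rw [← mul_assoc, ← mul_pow]
        congr 2
        field_simp
    _ = (∫ x : S2, (x : E3) 2 ^ k ∂(volume : Measure E3).toSphere) *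
          ∫ r : Set.Ioi (0 : ℝ), ((r : ℝ) ^ k * Real.exp (-(r : ℝ) ^ 2))
            ∂Measure.volumeIoiPow (Module.finrank ℝ E3 - 1) :=
        integral_prod_mul (L := ℝ) (fun x : S2 => (x : E3) 2 ^ k)
          (fun r : Set.Ioi (0 : ℝ) => (r : ℝ) ^ k * Real.exp (-(r : ℝ) ^ 2))
    _ = _ := by
        rw [hd, ← integral_rpow_exp_neg_sq]
        congr 1
        simp only [Measure.volumeIoiPow, ENNReal.ofReal]
        rw [integral_withDensity_eq_integral_smul, integral_subtype_comap measurableSet_Ioi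
          fun a : ℝ => Real.toNNReal (a ^ 2) • (a ^ k * Real.exp (-a ^ 2)),
          setIntegral_congr_fun measurableSet_Ioi fun x hx => ?_]
        · rw [NNReal.smul_def, Real.coe_toNNReal _ (pow_nonneg hx.out.le _), smul_eq_mul, pow_add]
          ring
        · exact (measurable_subtype_coe.pow_const _).real_toNNReal

theorem integral_toSphere_pow {k : ℕ} (hk : Even k) :
    ∫ x : S2, (x : E3) 2 ^ k ∂(volume : Measure E3).toSphere =
      4 * Real.Gamma (1 / 2) ^ 2 / (k + 1) := by
  have h := (integral_toSphere_pow_mul k).symm.trans (integral_E3_pow_exp_neg_sq hk)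
  have h1 : (((k + 2 : ℕ) : ℝ) + 1) / 2 = ((k : ℝ) + 1) / 2 + 1 := by push_cast; ring
  rw [h1, Real.Gamma_add_one (by positivity)] at h
  have h2 : 0 < Real.Gamma (((k : ℝ) + 1) / 2) := Real.Gamma_pos_of_pos (by positivity)
  rw [eq_div_iff (by positivity)]
  refine mul_right_cancel₀ h2.ne' ?_
  linear_combination 4 * h

theorem integral_sphere_eq (f : S2 → ℝ) : ∫ x, f x ∂sphereMeasure =
    (4 * Real.Gamma (1 / 2) ^ 2)⁻¹ * ∫ x, f x ∂(volume : Measure E3).toSphere := by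
  have h : (volume : Measure E3).toSphere.real Set.univ = 4 * Real.Gamma (1 / 2) ^ 2 := by
    have := integral_toSphere_pow (k := 0) (by simp)
    simpa using this
  rw [sphereMeasure, integral_smul_measure, ENNReal.toReal_inv, ← measureReal_def, h, smul_eq_mul]

theorem integral_sphere_pow (k : ℕ) :
    ∫ x, (x : E3) 2 ^ k ∂sphereMeasure = if Even k then 1 / ((k : ℝ) + 1) else 0 := by
  split_ifs with hk
  · rw [integral_sphere_eq, integral_toSphere_pow hk]
    have : 0 < Real.Gamma (1 / 2) := Real.Gamma_pos_of_pos (by norm_num)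
    field_simp
  · have h := integral_comp_sphereMap (LinearIsometryEquiv.neg ℝ)
      ((continuous_coord 2).pow k)
    have h2 : ∀ x : S2, ((sphereMap (LinearIsometryEquiv.neg ℝ) x : S2) : E3) 2 ^ k =
        -((x : E3) 2 ^ k) := fun x => by
      simp [sphereMap, (Nat.not_even_iff_odd.1 hk).neg_pow]
    simp only [Pi.pow_apply, h2, integral_neg] at h
    linarith

/-- Archimedes' theorem: the height has the moments of the uniform law on [-1, 1]. By linearity
monomials suffice. -/
theorem integral_sphere_polynomial (q : Polynomial ℝ) :
    ∫ x, q.eval ((x : E3) 2) ∂sphereMeasure = 1 / 2 * polyIntegral q := by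
  induction q using Polynomial.induction_on' with
  | add p q hp hq =>
    rw [polyIntegral_add, mul_add, ← hp, ← hq]
    simp only [Polynomial.eval_add]
    exact integral_add (integrable_of_continuous (p.continuous.comp (continuous_coord 2)))
      (integrable_of_continuous (q.continuous.comp (continuous_coord 2)))
  | monomial k a =>
    simp only [polyIntegral, Polynomial.eval_monomial, intervalIntegral.integral_const_mul,
      integral_const_mul, integral_pow, integral_sphere_pow]
    split_ifs with hk
    · rw [Odd.neg_one_pow (by simpa using hk.add_one)]
      field_simp
      norm_num
    · rw [Even.neg_one_pow (by simpa using (Nat.not_even_iff_odd.1 hk).add_one)]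
      simp

end Sphere

/-! ### Orthonormality of the spherical harmonics -/

section Harmonics

/-- The rotation about the polar axis by the angle `θ`. -/
def axisRotation (θ : ℝ) : E3 ≃ₗᵢ[ℝ] E3 :=
  LinearIsometry.toLinearIsometryEquiv
    { toFun := fun v => !₂[Real.cos θ * v 0 - Real.sin θ * v 1,
        Real.sin θ * v 0 + Real.cos θ * v 1, v 2]
      map_add' := fun v w => by
        ext i
        fin_cases i <;> simp <;> ring
      map_smul' := fun c v => by
        ext i
        fin_cases i <;> simp <;> ring
      norm_map' := fun v => by
        simp only [EuclideanSpace.norm_eq, Fin.sum_univ_three]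
        congr 1
        simp
        linear_combination (v 0 ^ 2 + v 1 ^ 2) * Real.sin_sq_add_cos_sq θ }
    rfl

theorem axisRotation_apply (θ : ℝ) (v : E3) :
    axisRotation θ v = !₂[Real.cos θ * v 0 - Real.sin θ * v 1,
        Real.sin θ * v 0 + Real.cos θ * v 1, v 2] := rfl

/-- The horizontal coordinates of a point of the sphere as a complex number. -/
def horizontal (x : S2) : ℂ :=
  (((x : E3) 0 : ℝ) : ℂ) + Complex.I * (((x : E3) 1 : ℝ) : ℂ)

theorem horizontal_sphereMap (θ : ℝ) (x : S2) :
    horizontal (sphereMap (axisRotation θ) x) = Complex.exp (θ * Complex.I) * horizontal x := by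
  simp only [horizontal, sphereMap, axisRotation_apply]
  rw [Complex.exp_mul_I]
  simp
  linear_combination (-Complex.sin θ * ((x : E3) 1 : ℝ)) * Complex.I_sq

theorem horizontal_mul_conj (x : S2) :
    horizontal x * starRingEnd ℂ (horizontal x) = ((1 - (x : E3) 2 ^ 2 : ℝ) : ℂ) := by
  have h : (x : E3) 0 ^ 2 + (x : E3) 1 ^ 2 + (x : E3) 2 ^ 2 = 1 := by
    have h1 := EuclideanSpace.norm_sq_eq (x : E3)
    rw [norm_eq_of_mem_sphere x, Fin.sum_univ_three] at h1
    simpa using h1.symm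
  rw [Complex.mul_conj, horizontal]
  congr 1
  simp [Complex.normSq_apply]
  linear_combination h

/-- The normalization of the spherical harmonics. -/
def harmonicNorm (l m : ℕ) : ℝ :=
  Real.sqrt ((2 * (l : ℝ) + 1) * ((l - m).factorial : ℝ) / ((l + m).factorial : ℝ))

theorem sphericalHarmonicNonneg_eq (l m : ℕ) (x : S2) :
    sphericalHarmonicNonneg l m x = (harmonicNorm l m : ℂ) * ((-1 : ℂ) ^ m *
      (((Polynomial.derivative^[m] (legendre l)).eval ((x : E3) 2) : ℝ) : ℂ) *
        horizontal x ^ m) := rfl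

theorem continuous_horizontal : Continuous horizontal :=
  (Complex.continuous_ofReal.comp (continuous_coord 0)).add
    (continuous_const.mul (Complex.continuous_ofReal.comp (continuous_coord 1)))

theorem continuous_sphericalHarmonicNonneg (l m : ℕ) :
    Continuous (sphericalHarmonicNonneg l m) := by
  have h : Continuous fun x : S2 =>
      (((Polynomial.derivative^[m] (legendre l)).eval ((x : E3) 2) : ℝ) : ℂ) :=
    Complex.continuous_ofReal.comp ((Polynomial.continuous _).comp (continuous_coord 2))
  exact continuous_const.mul ((continuous_const.mul h).mul (continuous_horizontal.pow m))

theorem continuous_sphericalHarmonic (l : ℕ) (m : ℤ) : Continuous (sphericalHarmonic l m) := by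
  unfold sphericalHarmonic
  split_ifs
  · exact continuous_sphericalHarmonicNonneg l _
  · exact continuous_const.mul
      (Complex.continuous_conj.comp (continuous_sphericalHarmonicNonneg l _))

theorem sphericalHarmonicNonneg_sphereMap (l m : ℕ) (θ : ℝ) (x : S2) :
    sphericalHarmonicNonneg l m (sphereMap (axisRotation θ) x) =
      Complex.exp (m * θ * Complex.I) * sphericalHarmonicNonneg l m x := by
  have h2 : ((sphereMap (axisRotation θ) x : S2) : E3) 2 = (x : E3) 2 := by
    simp [sphereMap, axisRotation_apply]
  rw [sphericalHarmonicNonneg_eq, sphericalHarmonicNonneg_eq, horizontal_sphereMap, h2, mul_pow,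
    ← Complex.exp_nat_mul, ← mul_assoc (m : ℂ)]
  ring

theorem sphericalHarmonic_sphereMap (l : ℕ) (m : ℤ) (θ : ℝ) (x : S2) :
    sphericalHarmonic l m (sphereMap (axisRotation θ) x) =
      Complex.exp (m * θ * Complex.I) * sphericalHarmonic l m x := by
  unfold sphericalHarmonic
  split_ifs with h
  · rw [sphericalHarmonicNonneg_sphereMap]
    congr 4
    rw [← Int.cast_natCast, Int.natAbs_of_nonneg h]
  · rw [sphericalHarmonicNonneg_sphereMap, map_mul, ← Complex.exp_conj]
    have : (m : ℂ) = -(m.natAbs : ℂ) := by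
      rw [← Int.cast_natCast, Int.ofNat_natAbs_of_nonpos (by omega)]
      simp
    rw [this]
    simp only [map_mul, Complex.conj_I, Complex.conj_ofReal, map_natCast]
    ring_nf

/-- For equal orders the azimuthal phases cancel and |x₀ + i x₁|^(2m) = (1 - x₂²)^m. What is left is
a polynomial in the height, with the Legendre weight. -/
theorem integral_sphericalHarmonicNonneg_mul_conj {l k m : ℕ} (hl : m ≤ l) (hk : m ≤ k) :
    ∫ x, sphericalHarmonicNonneg l m x * starRingEnd ℂ (sphericalHarmonicNonneg k m x)
      ∂sphereMeasure = if l = k then 1 else 0 := by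
  have h1 : ∀ x : S2, sphericalHarmonicNonneg l m x *
      starRingEnd ℂ (sphericalHarmonicNonneg k m x) =
      ((harmonicNorm l m * harmonicNorm k m * (Polynomial.derivative^[m] (legendre l) *
        weightedLegendre k m).eval ((x : E3) 2) : ℝ) : ℂ) := by
    intro x
    rw [sphericalHarmonicNonneg_eq, sphericalHarmonicNonneg_eq]
    have h2 := congrArg (· ^ m) (horizontal_mul_conj x)
    simp only [mul_pow] at h2
    have h3 : ((-1 : ℂ) ^ m) * (-1) ^ m = 1 := by rw [← mul_pow]; simp
    simp only [map_mul, map_pow, Complex.conj_ofReal, map_neg, map_one, weightedLegendre,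
      Polynomial.eval_mul, Polynomial.eval_pow, Polynomial.eval_sub, Polynomial.eval_one,
      Polynomial.eval_X, Complex.ofReal_mul, Complex.ofReal_pow]
    rw [← h2]
    linear_combination (harmonicNorm l m : ℂ) * harmonicNorm k m *
      ((Polynomial.derivative^[m] (legendre l)).eval ((x : E3) 2) : ℝ) *
      ((Polynomial.derivative^[m] (legendre k)).eval ((x : E3) 2) : ℝ) *
      horizontal x ^ m * starRingEnd ℂ (horizontal x) ^ m * h3
  simp only [h1]
  rw [integral_complex_ofReal, integral_const_mul, integral_sphere_polynomial,
    polyIntegral_legendre_mul hl hk]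
  split_ifs with h
  · subst h
    rw [harmonicNorm, Real.mul_self_sqrt (by positivity)]
    have p1 : ((l - m).factorial : ℝ) ≠ 0 := by positivity
    have p2 : ((l + m).factorial : ℝ) ≠ 0 := by positivity
    rw [← Complex.ofReal_one]
    congr 1
    field_simp
  · simp

theorem integral_sphericalHarmonic_mul_conj {l k : ℕ} {m n : ℤ} (hm : m.natAbs ≤ l) (hn : n.natAbs ≤ k) :
    ∫ x, sphericalHarmonic l m x * starRingEnd ℂ (sphericalHarmonic k n x) ∂sphereMeasure =
      if l = k ∧ m = n then 1 else 0 := by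
  by_cases hmn : m = n
  · subst hmn
    have h := integral_sphericalHarmonicNonneg_mul_conj hm hn
    by_cases h0 : 0 ≤ m
    · simpa [sphericalHarmonic, h0] using h
    · have h3 : ((-1 : ℂ) ^ m.natAbs) * (-1) ^ m.natAbs = 1 := by rw [← mul_pow]; simp
      have h2 : ∀ x : S2, sphericalHarmonic l m x * starRingEnd ℂ (sphericalHarmonic k m x) =
          starRingEnd ℂ (sphericalHarmonicNonneg l m.natAbs x *
            starRingEnd ℂ (sphericalHarmonicNonneg k m.natAbs x)) := by
        intro x
        simp only [sphericalHarmonic, if_neg h0, map_mul, map_pow, map_neg, map_one,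
          Complex.conj_conj]
        linear_combination starRingEnd ℂ (sphericalHarmonicNonneg l m.natAbs x) *
          sphericalHarmonicNonneg k m.natAbs x * h3
      simp only [h2, integral_conj, h, and_true]
      split_ifs <;> simp
  · rw [if_neg fun h => hmn h.2]
    have hc : Continuous fun x : S2 =>
        sphericalHarmonic l m x * starRingEnd ℂ (sphericalHarmonic k n x) :=
      (continuous_sphericalHarmonic l m).mul
        (Complex.continuous_conj.comp (continuous_sphericalHarmonic k n))
    -- Rotation by θ multiplies the integrand by exp(i(m-n)θ) = -1, so its invariant integral is
    -- zero.
    set θ : ℝ := Real.pi / ((m : ℝ) - n) with hθ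
    have h := integral_comp_sphereMap (axisRotation θ) hc
    have h2 : Complex.exp (m * θ * Complex.I) * starRingEnd ℂ (Complex.exp (n * θ * Complex.I)) =
        -1 := by
      rw [← Complex.exp_conj, ← Complex.exp_add]
      simp only [map_mul, Complex.conj_I, Complex.conj_ofReal, map_intCast]
      have hne : ((m : ℂ) - n) ≠ 0 := sub_ne_zero.2 (by exact_mod_cast hmn)
      rw [show (m : ℂ) * θ * Complex.I + n * θ * -Complex.I = Real.pi * Complex.I by
        rw [hθ]; push_cast; field_simp; ring]
      exact Complex.exp_pi_mul_I
    have h3 : ∀ x : S2, sphericalHarmonic l m (sphereMap (axisRotation θ) x) *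
        starRingEnd ℂ (sphericalHarmonic k n (sphereMap (axisRotation θ) x)) =
        -(sphericalHarmonic l m x * starRingEnd ℂ (sphericalHarmonic k n x)) := by
      intro x
      rw [sphericalHarmonic_sphereMap, sphericalHarmonic_sphereMap, map_mul]
      linear_combination sphericalHarmonic l m x * starRingEnd ℂ (sphericalHarmonic k n x) * h2
    simp only [h3, integral_neg] at h
    exact self_eq_neg.1 h.symm

/-- Parseval's identity for finite sums of spherical harmonics. -/
theorem integral_norm_sq_sum (s : Finset ((_ : ℕ) × ℤ)) (hs : ∀ p ∈ s, p.2.natAbs ≤ p.1) (b : (_ : ℕ) × ℤ → ℂ) :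
    ∫ x, ‖∑ p ∈ s, b p * sphericalHarmonic p.1 p.2 x‖ ^ 2 ∂sphereMeasure = ∑ p ∈ s, ‖b p‖ ^ 2 := by
  have h1 : ∀ x : S2, ((‖∑ p ∈ s, b p * sphericalHarmonic p.1 p.2 x‖ ^ 2 : ℝ) : ℂ) =
      ∑ p ∈ s, ∑ q ∈ s, b p * starRingEnd ℂ (b q) *
        (sphericalHarmonic p.1 p.2 x * starRingEnd ℂ (sphericalHarmonic q.1 q.2 x)) := by
    intro x
    rw [Complex.ofReal_pow, ← Complex.mul_conj', map_sum, Finset.sum_mul_sum]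
    refine Finset.sum_congr rfl fun p _ => Finset.sum_congr rfl fun q _ => ?_
    rw [map_mul]
    ring
  have hi : ∀ p q : (_ : ℕ) × ℤ, Integrable (fun x => b p * starRingEnd ℂ (b q) *
      (sphericalHarmonic p.1 p.2 x * starRingEnd ℂ (sphericalHarmonic q.1 q.2 x))) sphereMeasure :=
    fun p q => integrable_of_continuous (continuous_const.mul
      ((continuous_sphericalHarmonic _ _).mul
        (Complex.continuous_conj.comp (continuous_sphericalHarmonic _ _))))
  apply Complex.ofReal_injective
  rw [← integral_complex_ofReal]
  simp only [h1]
  rw [integral_finsetSum _ fun p _ => integrable_finsetSum _ fun q _ => hi p q, Complex.ofReal_sum]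
  refine Finset.sum_congr rfl fun p hp => ?_
  rw [integral_finsetSum _ fun q _ => hi p q, Finset.sum_eq_single_of_mem p hp]
  · rw [integral_const_mul, integral_sphericalHarmonic_mul_conj (hs p hp) (hs p hp), if_pos (by simp),
      mul_one, Complex.mul_conj', Complex.ofReal_pow]
  · intro q hq hqp
    rw [integral_const_mul, integral_sphericalHarmonic_mul_conj (hs p hp) (hs q hq), if_neg, mul_zero]
    rintro ⟨h1, h2⟩
    exact hqp (Sigma.ext h1.symm (heq_of_eq h2.symm))

end Harmonics

/-! ### The Wiener isometry -/

section L2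

variable {X : Type*} [MeasurableSpace X] {ν : Measure X}

theorem eLpNorm_two_sq {E : Type*} [NormedAddCommGroup E] (f : X → E) :
    eLpNorm f 2 ν ^ 2 = ∫⁻ x, ‖f x‖ₑ ^ 2 ∂ν := by
  have h := eLpNorm_nnreal_pow_eq_lintegral (μ := ν) (f := f) (p := 2) two_ne_zero
  simpa using h

theorem eLpNorm_two_le_sqrt {E : Type*} [NormedAddCommGroup E] {f : X → E} {K : ℝ}
    (h : ∫⁻ x, ‖f x‖ₑ ^ 2 ∂ν ≤ ENNReal.ofReal K) :
    eLpNorm f 2 ν ≤ ENNReal.ofReal (Real.sqrt K) := by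
  rw [← eLpNorm_two_sq] at h
  have h2 : ENNReal.ofReal (Real.sqrt K) ^ 2 = ENNReal.ofReal K := by
    rcases le_total 0 K with hK | hK
    · rw [← ENNReal.ofReal_pow (Real.sqrt_nonneg K), Real.sq_sqrt hK]
    · rw [Real.sqrt_eq_zero_of_nonpos hK, ENNReal.ofReal_of_nonpos hK]; simp
  rw [← h2] at h
  exact (ENNReal.pow_le_pow_left_iff two_ne_zero).1 h

theorem lintegral_enorm_sq_eq_ofReal {E : Type*} [NormedAddCommGroup E] {f : X → E}
    (hf : MemLp f 2 ν) : ∫⁻ x, ‖f x‖ₑ ^ 2 ∂ν = ENNReal.ofReal (∫ x, ‖f x‖ ^ 2 ∂ν) := by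
  rw [ofReal_integral_eq_lintegral_ofReal
    ((memLp_two_iff_integrable_sq_norm hf.1).1 hf) (Eventually.of_forall fun x => by positivity)]
  refine lintegral_congr fun x => ?_
  rw [ENNReal.ofReal_pow (norm_nonneg _), ofReal_norm]

theorem integral_sum_sq {ι : Type*} (s : Finset ι) (x : ι → ℝ) {f : ι → X → ℝ}
    (hf : ∀ i ∈ s, MemLp (f i) 2 ν) :
    ∫ z, (∑ i ∈ s, x i * f i z) ^ 2 ∂ν =
      ∑ i ∈ s, ∑ j ∈ s, x i * x j * ∫ z, f i z * f j z ∂ν := by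
  have hi : ∀ i ∈ s, ∀ j ∈ s, Integrable (fun z => x i * x j * (f i z * f j z)) ν :=
    fun i hi j hj => ((hf i hi).integrable_mul (hf j hj)).const_mul _
  calc ∫ z, (∑ i ∈ s, x i * f i z) ^ 2 ∂ν
      = ∫ z, ∑ i ∈ s, ∑ j ∈ s, x i * x j * (f i z * f j z) ∂ν := by
        refine integral_congr_ae (Eventually.of_forall fun z => ?_)
        simp only [sq, Finset.sum_mul_sum]
        exact Finset.sum_congr rfl fun i _ => Finset.sum_congr rfl fun j _ => by ring
    _ = _ := by
        rw [integral_finsetSum _ fun i h => integrable_finsetSum _ fun j h' => hi i h j h']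
        refine Finset.sum_congr rfl fun i h => ?_
        rw [integral_finsetSum _ fun j h' => hi i h j h']
        exact Finset.sum_congr rfl fun j _ => integral_const_mul _ _

end L2

section WienerIsometry

variable {Ω : Type*} [MeasurableSpace Ω] {P : Measure Ω}

/-- A real process on `[0, ∞)` with independent increments, the increment over `[s, t]` being
centered Gaussian with variance `(t - s) v`. -/
structure IsScaledWiener (P : Measure Ω) (v : ℝ) (X : ℝ → Ω → ℝ) : Prop where
  nonneg : 0 ≤ v
  law : ∀ s t : ℝ, 0 ≤ s → s ≤ t →
    HasLaw (fun ω => X t ω - X s ω) (gaussianReal 0 (Real.toNNReal ((t - s) * v))) P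
  indep : ∀ s t : ℝ, 0 ≤ s → s ≤ t →
    IndepFun (fun ω => X s ω - X 0 ω) (fun ω => X t ω - X s ω) P

namespace IsScaledWiener

variable {v : ℝ} {X : ℝ → Ω → ℝ}

theorem memLp (hX : IsScaledWiener P v X) {s t : ℝ} (hs : 0 ≤ s) (hst : s ≤ t) :
    MemLp (fun ω => X t ω - X s ω) 2 P := by
  have h := hX.law s t hs hst
  have h2 : MemLp id 2 (P.map fun ω => X t ω - X s ω) := by
    rw [h.map_eq]; exact memLp_id_gaussianReal' 2 (by simp)
  exact (memLp_map_measure_iff h2.1 h.aemeasurable).1 h2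

theorem integral_eq_zero (hX : IsScaledWiener P v X) {s t : ℝ} (hs : 0 ≤ s) (hst : s ≤ t) :
    ∫ ω, (X t ω - X s ω) ∂P = 0 := by
  rw [(hX.law s t hs hst).integral_eq, integral_id_gaussianReal]

theorem integral_sq (hX : IsScaledWiener P v X) {s t : ℝ} (hs : 0 ≤ s) (hst : s ≤ t) :
    ∫ ω, (X t ω - X s ω) ^ 2 ∂P = (t - s) * v := by
  have h := hX.law s t hs hst
  have h2 := h.variance_eq
  rw [variance_id_gaussianReal, variance_of_integral_eq_zero h.aemeasurable
    (hX.integral_eq_zero hs hst),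
    Real.coe_toNNReal _ (mul_nonneg (sub_nonneg.2 hst) hX.nonneg)] at h2
  exact h2

theorem integral_mul_of_le (hX : IsScaledWiener P v X) {s t : ℝ} (hs : 0 ≤ s) (hst : s ≤ t) :
    ∫ ω, (X s ω - X 0 ω) * (X t ω - X 0 ω) ∂P = s * v := by
  have m1 := hX.memLp le_rfl hs
  have m2 := hX.memLp hs hst
  have h1 : ∀ ω, (X s ω - X 0 ω) * (X t ω - X 0 ω) =
      (X s ω - X 0 ω) ^ 2 + (X s ω - X 0 ω) * (X t ω - X s ω) := fun ω => by ring
  have m3 : Integrable (fun ω => (X s ω - X 0 ω) * (X t ω - X s ω)) P := m1.integrable_mul m2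
  simp only [h1]
  rw [integral_add m1.integrable_sq m3, hX.integral_sq le_rfl hs,
    (hX.indep s t hs hst).integral_fun_mul_eq_mul_integral m1.1 m2.1, hX.integral_eq_zero le_rfl hs]
  ring

theorem integral_mul (hX : IsScaledWiener P v X) {s t : ℝ} (hs : 0 ≤ s) (ht : 0 ≤ t) :
    ∫ ω, (X s ω - X 0 ω) * (X t ω - X 0 ω) ∂P = min s t * v := by
  rcases le_total s t with h | h
  · rw [min_eq_left h, hX.integral_mul_of_le hs h]
  · rw [min_eq_right h, ← hX.integral_mul_of_le ht h]
    simp only [mul_comm]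

/-- Expanding in increments from time 0 gives four covariances v·min. Their alternating sum is v
times the length of the overlap of the two intervals. -/
theorem integral_increment_mul (hX : IsScaledWiener P v X) {a b c d : ℝ} (ha : 0 ≤ a) (hab : a ≤ b)
    (hc : 0 ≤ c) (hcd : c ≤ d) :
    ∫ ω, (X b ω - X a ω) * (X d ω - X c ω) ∂P =
      v * ∫ u, (Set.Ioc a b).indicator 1 u * (Set.Ioc c d).indicator (1 : ℝ → ℝ) u := by
  have hb := ha.trans hab
  have hd := hc.trans hcd
  have m : ∀ {s t : ℝ}, 0 ≤ s → 0 ≤ t →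
      Integrable (fun ω => (X s ω - X 0 ω) * (X t ω - X 0 ω)) P :=
    fun hs ht => (hX.memLp le_rfl hs).integrable_mul (hX.memLp le_rfl ht)
  have h1 : ∀ ω, (X b ω - X a ω) * (X d ω - X c ω) =
      ((X b ω - X 0 ω) * (X d ω - X 0 ω) - (X b ω - X 0 ω) * (X c ω - X 0 ω)) -
      ((X a ω - X 0 ω) * (X d ω - X 0 ω) - (X a ω - X 0 ω) * (X c ω - X 0 ω)) :=
    fun ω => by ring
  have h2 : ∀ u, (Set.Ioc a b).indicator 1 u * (Set.Ioc c d).indicator (1 : ℝ → ℝ) u =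
      (Set.Ioc (max a c) (min b d)).indicator 1 u := fun u => by
    rw [← Set.Ioc_inter_Ioc, Set.inter_indicator_one]; rfl
  have h3 : ∀ {t : ℝ}, 0 ≤ t → Integrable (fun ω =>
      (X t ω - X 0 ω) * (X d ω - X 0 ω) - (X t ω - X 0 ω) * (X c ω - X 0 ω)) P :=
    fun ht => (m ht hd).sub (m ht hc)
  simp only [h1, h2]
  rw [integral_sub (h3 hb) (h3 ha),
    integral_sub (m hb hd) (m hb hc), integral_sub (m ha hd) (m ha hc), hX.integral_mul hb hd,
    hX.integral_mul hb hc, hX.integral_mul ha hd, hX.integral_mul ha hc,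
    integral_indicator_one measurableSet_Ioc, measureReal_def, Real.volume_Ioc]
  rcases le_total (max a c) (min b d) with h | h
  · rw [ENNReal.toReal_ofReal (sub_nonneg.2 h), ← sub_mul, ← sub_mul, ← sub_mul, mul_comm]
    congr 1
    grind
  · rw [ENNReal.ofReal_of_nonpos (by linarith), ← sub_mul, ← sub_mul, ← sub_mul, mul_comm]
    congr 1
    simp only [ENNReal.toReal_zero]
    grind

theorem integral_sum_increment_sq (hX : IsScaledWiener P v X) {ι : Type*} (s : Finset ι)
    (x a b : ι → ℝ) (ha : ∀ i ∈ s, 0 ≤ a i) (hab : ∀ i ∈ s, a i ≤ b i) :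
    ∫ ω, (∑ i ∈ s, x i * (X (b i) ω - X (a i) ω)) ^ 2 ∂P =
      v * ∫ u, (∑ i ∈ s, x i * (Set.Ioc (a i) (b i)).indicator (1 : ℝ → ℝ) u) ^ 2 := by
  rw [integral_sum_sq s x fun i hi => hX.memLp (ha i hi) (hab i hi),
    integral_sum_sq s x (f := fun i u => (Set.Ioc (a i) (b i)).indicator (1 : ℝ → ℝ) u)
      fun i _ => memLp_indicator_const 2 measurableSet_Ioc (1 : ℝ) (Or.inr (by simp)),
    Finset.mul_sum]
  refine Finset.sum_congr rfl fun i hi => ?_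
  rw [Finset.mul_sum]
  refine Finset.sum_congr rfl fun j hj => ?_
  rw [hX.integral_increment_mul (ha i hi) (hab i hi) (ha j hj) (hab j hj)]
  ring

end IsScaledWiener

/-! ### Integrals of step functions. -/

namespace StepFunction

variable {a b : ℝ}

theorem le_node (s : StepFunction a b) (i : ℕ) : a ≤ s.node i :=
  s.node_zero.symm.trans_le (s.mono (Nat.zero_le i))

/-- The integral of a step function with respect to a real process. -/
def realIntegral {Ω : Type*} (s : StepFunction a b) (X : ℝ → Ω → ℝ) (ω : Ω) : ℝ :=
  ∑ i ∈ Finset.range s.n, s.val i * (X (s.node (i + 1)) ω - X (s.node i) ω)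

theorem integral_re {Ω : Type*} (s : StepFunction a b) (B : ℝ → Ω → ℂ) (ω : Ω) :
    (s.integral B ω).re = s.realIntegral (fun t ω => (B t ω).re) ω := by
  simp [integral, realIntegral, Complex.re_sum]

theorem integral_im {Ω : Type*} (s : StepFunction a b) (B : ℝ → Ω → ℂ) (ω : Ω) :
    (s.integral B ω).im = s.realIntegral (fun t ω => (B t ω).im) ω := by
  simp [integral, realIntegral, Complex.im_sum]

theorem toFun_eq (s : StepFunction a b) (u : ℝ) : s.toFun u =
    ∑ i ∈ Finset.range s.n, s.val i *
      (Set.Ioc (s.node i) (s.node (i + 1))).indicator (1 : ℝ → ℝ) u := by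
  refine Finset.sum_congr rfl fun i _ => ?_
  by_cases h : u ∈ Set.Ioc (s.node i) (s.node (i + 1)) <;> simp [h]

theorem memLp_toFun (s : StepFunction a b) : MemLp s.toFun 2 volume := by
  have : s.toFun = fun u => ∑ i ∈ Finset.range s.n,
    (Set.Ioc (s.node i) (s.node (i + 1))).indicator (fun _ => s.val i) u := rfl
  rw [this]
  exact memLp_finsetSum _ fun i _ => memLp_indicator_const 2 measurableSet_Ioc _ (Or.inr (by simp))

theorem toFun_eq_zero (s : StepFunction a b) {u : ℝ} (hu : u ∉ Set.Icc a b) : s.toFun u = 0 := by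
  refine Finset.sum_eq_zero fun i hi => Set.indicator_of_notMem (fun h => hu ?_) _
  refine ⟨(s.le_node i).trans h.1.le, h.2.trans ?_⟩
  exact (s.mono (Finset.mem_range.1 hi)).trans_eq s.node_last

theorem memLp_realIntegral {v : ℝ} {X : ℝ → Ω → ℝ} (hX : IsScaledWiener P v X) (ha : 0 ≤ a)
    (s : StepFunction a b) : MemLp (s.realIntegral X) 2 P := by
  have : s.realIntegral X = fun ω => ∑ i ∈ Finset.range s.n,
    s.val i * (X (s.node (i + 1)) ω - X (s.node i) ω) := rfl
  rw [this]
  exact memLp_finsetSum _ fun i _ =>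
    (hX.memLp (ha.trans (s.le_node i)) (s.mono (Nat.le_succ i))).const_mul _

/-- The difference is a single sum over the disjoint union of both index sets. As the isometry
allows overlapping intervals, no common refinement is needed. -/
theorem integral_realIntegral_sub_sq {c d v : ℝ} {X : ℝ → Ω → ℝ} (hX : IsScaledWiener P v X)
    (ha : 0 ≤ a) (hc : 0 ≤ c) (s : StepFunction a b) (r : StepFunction c d) :
    ∫ ω, (s.realIntegral X ω - r.realIntegral X ω) ^ 2 ∂P =
      v * ∫ u, (s.toFun u - r.toFun u) ^ 2 := by
  have h := hX.integral_sum_increment_sq ((Finset.range s.n).disjSum (Finset.range r.n))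
    (Sum.elim s.val fun i => -r.val i) (Sum.elim s.node r.node)
    (Sum.elim (fun i => s.node (i + 1)) fun i => r.node (i + 1))
    (fun i _ => by
      rcases i with i | i
      · exact ha.trans (s.le_node i)
      · exact hc.trans (r.le_node i))
    (fun i _ => by
      rcases i with i | i
      · exact s.mono (Nat.le_succ i)
      · exact r.mono (Nat.le_succ i))
  simpa only [realIntegral, Finset.sum_disjSum, Sum.elim_inl, Sum.elim_inr, neg_mul, Finset.sum_neg_distrib,
    ← sub_eq_add_neg, ← toFun_eq] using h

end StepFunction

/-- The Wiener isometry for step functions and a complex process. -/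
theorem eLpNorm_stepIntegral_sub {B : ℝ → Ω → ℂ} {v₁ v₂ : ℝ}
    (h1 : IsScaledWiener P v₁ fun t ω => (B t ω).re)
    (h2 : IsScaledWiener P v₂ fun t ω => (B t ω).im) {b d : ℝ}
    (s : StepFunction 0 b) (r : StepFunction 0 d) :
    eLpNorm (fun ω => s.integral B ω - r.integral B ω) 2 P =
      ENNReal.ofReal (Real.sqrt (v₁ + v₂)) * eLpNorm (fun u => s.toFun u - r.toFun u) 2 volume := by
  have hv : 0 ≤ v₁ + v₂ := add_nonneg h1.nonneg h2.nonneg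
  refine (ENNReal.pow_right_strictMono two_ne_zero).injective ?_
  have m1 : MemLp (fun ω => s.realIntegral (fun t ω => (B t ω).re) ω -
      r.realIntegral (fun t ω => (B t ω).re) ω) 2 P :=
    (s.memLp_realIntegral h1 le_rfl).sub (r.memLp_realIntegral h1 le_rfl)
  have m2 : MemLp (fun ω => s.realIntegral (fun t ω => (B t ω).im) ω -
      r.realIntegral (fun t ω => (B t ω).im) ω) 2 P :=
    (s.memLp_realIntegral h2 le_rfl).sub (r.memLp_realIntegral h2 le_rfl)
  have m3 := s.memLp_toFun.sub r.memLp_toFun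
  have m4 : Integrable (fun ω => (s.realIntegral (fun t ω => (B t ω).re) ω -
      r.realIntegral (fun t ω => (B t ω).re) ω) ^ 2 + (s.realIntegral (fun t ω => (B t ω).im) ω -
      r.realIntegral (fun t ω => (B t ω).im) ω) ^ 2) P := m1.integrable_sq.add m2.integrable_sq
  -- The squared modulus splits into real and imaginary squares, so the variances add and no cross
  -- term between the two parts appears.
  have e1 : ∫⁻ ω, ‖s.integral B ω - r.integral B ω‖ₑ ^ 2 ∂P =
      ENNReal.ofReal ((v₁ + v₂) * ∫ u, (s.toFun u - r.toFun u) ^ 2) := by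
    rw [add_mul, ← StepFunction.integral_realIntegral_sub_sq h1 le_rfl le_rfl s r,
      ← StepFunction.integral_realIntegral_sub_sq h2 le_rfl le_rfl s r]
    rw [← integral_add m1.integrable_sq m2.integrable_sq, ofReal_integral_eq_lintegral_ofReal
      m4 (Eventually.of_forall fun ω => by positivity)]
    refine lintegral_congr fun ω => ?_
    rw [← ofReal_norm, ← ENNReal.ofReal_pow (norm_nonneg _), Complex.sq_norm, Complex.normSq_apply,
      Complex.sub_re, Complex.sub_im, s.integral_re, r.integral_re, s.integral_im, r.integral_im]
    simp only [sq]
  rw [mul_pow, ← ENNReal.ofReal_pow (Real.sqrt_nonneg _), Real.sq_sqrt hv, eLpNorm_two_sq,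
    eLpNorm_two_sq, e1, ENNReal.ofReal_mul hv]
  congr 1
  have := lintegral_enorm_sq_eq_ofReal m3
  simp only [Pi.sub_apply, Real.norm_eq_abs, sq_abs] at this
  exact this.symm

theorem aestronglyMeasurable_stepIntegral {B : ℝ → Ω → ℂ} {b : ℝ} (s : StepFunction 0 b)
    (hB : ∀ t, 0 ≤ t → AEStronglyMeasurable (B t) P) : AEStronglyMeasurable (s.integral B) P := by
  have : s.integral B = fun ω => ∑ i ∈ Finset.range s.n,
    (s.val i : ℂ) * (B (s.node (i + 1)) ω - B (s.node i) ω) := rfl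
  rw [this]
  exact Finset.aestronglyMeasurable_fun_sum _ fun i _ =>
    ((hB _ (s.le_node _)).sub (hB _ (s.le_node _))).const_mul _

/-- The distance of two Wiener integrals of deterministic functions is at most the distance of the
integrands, each extended by zero. -/
theorem eLpNorm_wienerIntegral_sub_le {B : ℝ → Ω → ℂ} {v₁ v₂ : ℝ}
    (h1 : IsScaledWiener P v₁ fun t ω => (B t ω).re)
    (h2 : IsScaledWiener P v₂ fun t ω => (B t ω).im)
    (hB : ∀ t, 0 ≤ t → AEStronglyMeasurable (B t) P) {b d : ℝ} {f g : ℝ → ℝ} {I J : Ω → ℂ}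
    (hf : AEStronglyMeasurable ((Set.Icc 0 b).indicator f) volume)
    (hg : AEStronglyMeasurable ((Set.Icc 0 d).indicator g) volume)
    (hI : IsWienerIntegral P B 0 b f I) (hJ : IsWienerIntegral P B 0 d g J) :
    eLpNorm (fun ω => I ω - J ω) 2 P ≤ ENNReal.ofReal (Real.sqrt (v₁ + v₂)) *
      eLpNorm (fun u => (Set.Icc 0 b).indicator f u - (Set.Icc 0 d).indicator g u) 2 volume := by
  obtain ⟨mI, s, hs1, hs2⟩ := hI
  obtain ⟨mJ, r, hr1, hr2⟩ := hJ
  -- Step functions vanish off [0, b], so the approximation in L²([0, b]) holds on the whole line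
  -- for the zero extensions. There, integrands with different horizons can be compared.
  have ext : ∀ {b : ℝ} {f : ℝ → ℝ} (s : StepFunction 0 b),
      eLpNorm (fun u => s.toFun u - f u) 2 (volume.restrict (Set.Icc 0 b)) =
        eLpNorm (fun u => s.toFun u - (Set.Icc 0 b).indicator f u) 2 volume := by
    intro b f s
    rw [← eLpNorm_indicator_eq_eLpNorm_restrict measurableSet_Icc]
    congr 1
    ext u
    by_cases hu : u ∈ Set.Icc 0 b
    · simp [hu]
    · simp [hu, s.toFun_eq_zero hu]
  simp only [ext] at hs1 hr1
  set F := (Set.Icc 0 b).indicator f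
  set G := (Set.Icc 0 d).indicator g
  set q := ENNReal.ofReal (Real.sqrt (v₁ + v₂)) with hq
  -- This sequence dominates the left side for every k, by the triangle inequality on both sides of
  -- the step isometry. Its approximation errors tend to zero.
  have hlim : Tendsto (fun k => eLpNorm (fun ω => I ω - (s k).integral B ω) 2 P +
      q * (eLpNorm (fun u => (s k).toFun u - F u) 2 volume +
        eLpNorm (fun u => F u - G u) 2 volume + eLpNorm (fun u => (r k).toFun u - G u) 2 volume) +
      eLpNorm (fun ω => J ω - (r k).integral B ω) 2 P) atTop
      (𝓝 (0 + q * (0 + eLpNorm (fun u => F u - G u) 2 volume + 0) + 0)) :=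
    (hs2.add (ENNReal.Tendsto.const_mul ((hs1.add tendsto_const_nhds).add hr1)
      (Or.inr ENNReal.ofReal_ne_top))).add hr2
  simp only [zero_add, add_zero] at hlim
  refine ge_of_tendsto' hlim fun k => ?_
  have ms := aestronglyMeasurable_stepIntegral (s k) hB
  have mr := aestronglyMeasurable_stepIntegral (r k) hB
  have e1 : (fun ω => I ω - J ω) = (fun ω => I ω - (s k).integral B ω) +
      (fun ω => (s k).integral B ω - (r k).integral B ω) -
      (fun ω => J ω - (r k).integral B ω) := by
    ext ω; simp only [Pi.add_apply, Pi.sub_apply]; ring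
  have e2 : (fun u => (s k).toFun u - (r k).toFun u) = (fun u => (s k).toFun u - F u) +
      (fun u => F u - G u) - (fun u => (r k).toFun u - G u) := by
    ext u; simp only [Pi.add_apply, Pi.sub_apply]; ring
  have n1 := (s k).memLp_toFun.1.sub hf
  have n2 := hf.sub hg
  have n3 := (r k).memLp_toFun.1.sub hg
  rw [e1]
  refine (eLpNorm_sub_le ((mI.1.sub ms).add (ms.sub mr)) (mJ.1.sub mr) one_le_two).trans ?_
  refine add_le_add_left ((eLpNorm_add_le (mI.1.sub ms) (ms.sub mr) one_le_two).trans ?_) _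
  refine add_le_add_right ?_ _
  change eLpNorm (fun ω => (s k).integral B ω - (r k).integral B ω) 2 P ≤ _
  rw [eLpNorm_stepIntegral_sub h1 h2, e2]
  refine mul_le_mul_right ?_ _
  refine (eLpNorm_sub_le (n1.add n2) n3 one_le_two).trans ?_
  exact add_le_add_left (eLpNorm_add_le n1 n2 one_le_two) _

end WienerIsometry

/-! ### Increments of the relaxation function in mean square -/

section RelaxationIncrement

variable {α lam b d : ℝ}

theorem monotoneOn_relaxation_sub (hα : 0 < α) (hα1 : α ≤ 1) (hl : 0 ≤ lam) (b : ℝ) :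
    MonotoneOn (fun s => relaxation α lam (b - s)) (Set.Iic b) := fun _ hs _ ht hst =>
  relaxation_antitoneOn hα hα1 hl (sub_nonneg.2 (Set.mem_Iic.1 ht)) (sub_nonneg.2 (Set.mem_Iic.1 hs))
    (sub_le_sub_left hst b)

theorem aestronglyMeasurable_indicator_relaxation (hα : 0 < α) (hα1 : α ≤ 1) (hl : 0 ≤ lam)
    (b : ℝ) : AEStronglyMeasurable
      ((Set.Icc 0 b).indicator fun s => relaxation α lam (b - s)) volume :=
  ((aemeasurable_indicator_iff measurableSet_Icc).2 (aemeasurable_restrict_of_monotoneOn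
    measurableSet_Icc ((monotoneOn_relaxation_sub hα hα1 hl b).mono
      Set.Icc_subset_Iic_self))).aestronglyMeasurable

theorem intervalIntegrable_relaxation (hα : 0 < α) (hα1 : α ≤ 1) (hl : 0 ≤ lam) {x y : ℝ}
    (hx : 0 ≤ x) (hy : 0 ≤ y) : IntervalIntegrable (relaxation α lam) volume x y :=
  ((relaxation_antitoneOn hα hα1 hl).mono fun _ hz =>
    (le_min hx hy).trans (Set.mem_Icc.1 hz).1).intervalIntegrable

/-- After substitution the integral telescopes to ∫ r over [0, b-d] minus ∫ r over [d, b]. The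
bounds 0 ≤ r ≤ 1 give an estimate uniform in λ. -/
theorem integral_relaxation_sub_le (hα : 0 < α) (hα1 : α ≤ 1) (hl : 0 ≤ lam) (hd : 0 ≤ d)
    (hdb : d ≤ b) :
    ∫ u in (0 : ℝ)..d, (relaxation α lam (d - u) - relaxation α lam (b - u)) ≤ b - d := by
  have hb : 0 ≤ b := hd.trans hdb
  have hbd : 0 ≤ b - d := sub_nonneg.2 hdb
  have ii : ∀ {x y : ℝ}, 0 ≤ x → 0 ≤ y → IntervalIntegrable (relaxation α lam) volume x y :=
    intervalIntegrable_relaxation hα hα1 hl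
  have i1 : IntervalIntegrable (fun u => relaxation α lam (d - u)) volume 0 d := by
    have := (ii hd le_rfl).comp_sub_left d
    simpa using this
  have i2 : IntervalIntegrable (fun u => relaxation α lam (b - u)) volume 0 d := by
    have := (ii hb hbd).comp_sub_left b
    simpa using this
  rw [intervalIntegral.integral_sub i1 i2, intervalIntegral.integral_comp_sub_left (relaxation α lam),
    intervalIntegral.integral_comp_sub_left (relaxation α lam), sub_self, sub_zero, sub_zero]
  have e1 := intervalIntegral.integral_add_adjacent_intervals (ii le_rfl hd) (ii hd hb)
  have e2 := intervalIntegral.integral_add_adjacent_intervals (ii le_rfl hbd) (ii hbd hb)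
  have e3 : ∫ u in (0 : ℝ)..(b - d), relaxation α lam u ≤ ∫ _ in (0 : ℝ)..(b - d), (1 : ℝ) :=
    intervalIntegral.integral_mono_on hbd (ii le_rfl hbd) (by simp)
      fun u hu => relaxation_le_one hα hα1 hl hu.1
  have e4 : 0 ≤ ∫ u in d..b, relaxation α lam u :=
    intervalIntegral.integral_nonneg hdb fun u hu => relaxation_nonneg hα hα1 hl (hd.trans hu.1)
  rw [intervalIntegral.integral_const, smul_eq_mul, mul_one] at e3
  linarith

theorem enorm_sq_le_ofReal {x y : ℝ} (h : x ^ 2 ≤ y) : ‖x‖ₑ ^ 2 ≤ ENNReal.ofReal y := by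
  rw [← ofReal_norm, ← ENNReal.ofReal_pow (norm_nonneg _), Real.norm_eq_abs, sq_abs]
  exact ENNReal.ofReal_le_ofReal h

/-- The factor 2 collects two contributions of b - d: on [0, d] the difference D lies in [0, 1], so
D² ≤ D and the telescoping bound applies; on (d, b] only one kernel remains, with square at most 1.
-/
theorem eLpNorm_relaxation_sub_le (hα : 0 < α) (hα1 : α ≤ 1) (hl : 0 ≤ lam) (hd : 0 ≤ d)
    (hdb : d ≤ b) :
    eLpNorm (fun u => (Set.Icc 0 b).indicator (fun s => relaxation α lam (b - s)) u -
      (Set.Icc 0 d).indicator (fun s => relaxation α lam (d - s)) u) 2 volume ≤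
      ENNReal.ofReal (Real.sqrt (2 * (b - d))) := by
  refine eLpNorm_two_le_sqrt ?_
  set D : ℝ → ℝ := fun u => relaxation α lam (d - u) - relaxation α lam (b - u) with hD
  have hD0 : ∀ u ∈ Set.Icc 0 d, 0 ≤ D u := fun u hu => sub_nonneg.2
    (relaxation_antitoneOn hα hα1 hl (sub_nonneg.2 hu.2) (sub_nonneg.2 (hu.2.trans hdb))
      (sub_le_sub_right hdb u))
  have hD1 : ∀ u ∈ Set.Icc 0 d, D u ≤ 1 := fun u hu => by
    have h1 := relaxation_le_one hα hα1 hl (sub_nonneg.2 hu.2)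
    have h2 := relaxation_nonneg hα hα1 hl (sub_nonneg.2 (hu.2.trans hdb))
    simp only [hD]
    linarith
  have key : ∀ u, ‖(Set.Icc 0 b).indicator (fun s => relaxation α lam (b - s)) u -
      (Set.Icc 0 d).indicator (fun s => relaxation α lam (d - s)) u‖ₑ ^ 2 ≤
      (Set.Icc 0 d).indicator (fun u => ENNReal.ofReal (D u)) u +
        (Set.Ioc d b).indicator 1 u := by
    intro u
    by_cases h1 : u ∈ Set.Icc 0 d
    · rw [Set.indicator_of_mem h1, Set.indicator_of_mem h1,
        Set.indicator_of_mem (Set.Icc_subset_Icc_right hdb h1)]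
      refine le_add_of_le_of_nonneg (enorm_sq_le_ofReal ?_) zero_le
      nlinarith [hD0 u h1, hD1 u h1]
    · rw [Set.indicator_of_notMem h1, Set.indicator_of_notMem h1, sub_zero, zero_add]
      by_cases h2 : u ∈ Set.Ioc d b
      · rw [Set.indicator_of_mem h2, Set.indicator_of_mem
          (show u ∈ Set.Icc 0 b from ⟨hd.trans h2.1.le, h2.2⟩), Pi.one_apply,
          ← ENNReal.ofReal_one]
        have h3 := relaxation_le_one hα hα1 hl (sub_nonneg.2 h2.2)
        have h4 := relaxation_nonneg hα hα1 hl (sub_nonneg.2 h2.2)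
        exact enorm_sq_le_ofReal (by nlinarith)
      · have h3 : u ∉ Set.Icc 0 b := fun h => by
          by_cases h4 : u ≤ d
          · exact h1 ⟨h.1, h4⟩
          · exact h2 ⟨not_le.1 h4, h.2⟩
        rw [Set.indicator_of_notMem h3]
        simp
  refine (lintegral_mono key).trans ?_
  rw [lintegral_add_right _ (measurable_one.indicator measurableSet_Ioc),
    lintegral_indicator_one measurableSet_Ioc, lintegral_indicator measurableSet_Icc,
    Real.volume_Ioc, two_mul, ENNReal.ofReal_add (sub_nonneg.2 hdb) (sub_nonneg.2 hdb)]
  refine add_le_add_left ?_ _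
  have hint : IntegrableOn D (Set.Icc 0 d) := by
    rw [integrableOn_Icc_iff_integrableOn_Ioc, ← intervalIntegrable_iff_integrableOn_Ioc_of_le hd]
    refine IntervalIntegrable.sub ?_ ?_
    · have := (intervalIntegrable_relaxation hα hα1 hl hd le_rfl).comp_sub_left d
      simpa using this
    · have := (intervalIntegrable_relaxation hα hα1 hl (hd.trans hdb)
        (sub_nonneg.2 hdb)).comp_sub_left b
      simpa using this
  rw [← ofReal_integral_eq_lintegral_ofReal hint
    ((ae_restrict_iff' measurableSet_Icc).2 (Eventually.of_forall hD0))]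
  refine ENNReal.ofReal_le_ofReal ?_
  rw [integral_Icc_eq_integral_Ioc, ← intervalIntegral.integral_of_le hd]
  exact integral_relaxation_sub_le hα hα1 hl hd hdb

end RelaxationIncrement

/-! ### Fourier coefficients -/

section Fourier

theorem memLp_of_continuous {F : Type*} [NormedAddCommGroup F] {f : S2 → F} (hf : Continuous f) :
    MemLp f 2 sphereMeasure :=
  hf.memLp_of_hasCompactSupport (HasCompactSupport.of_compactSpace f)

theorem memLp_harmonic_re (l : ℕ) (m : ℤ) :
    MemLp (fun x => (sphericalHarmonic l m x).re) 2 sphereMeasure :=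
  memLp_of_continuous (Complex.continuous_re.comp (continuous_sphericalHarmonic l m))

theorem memLp_harmonic_im (l : ℕ) (m : ℤ) :
    MemLp (fun x => (sphericalHarmonic l m x).im) 2 sphereMeasure :=
  memLp_of_continuous (Complex.continuous_im.comp (continuous_sphericalHarmonic l m))

/-- The real part of a spherical harmonic. -/
def harmonicRe (l : ℕ) (m : ℤ) : L2S := (memLp_harmonic_re l m).toLp

/-- The imaginary part of a spherical harmonic. -/
def harmonicIm (l : ℕ) (m : ℤ) : L2S := (memLp_harmonic_im l m).toLp

theorem inner_harmonicRe (f : L2S) (l : ℕ) (m : ℤ) :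
    inner ℝ f (harmonicRe l m) = ∫ x, f x * (sphericalHarmonic l m x).re ∂sphereMeasure := by
  rw [L2.inner_def]
  refine integral_congr_ae ?_
  filter_upwards [(memLp_harmonic_re l m).coeFn_toLp] with x hx
  rw [harmonicRe, hx]
  simp [mul_comm]

theorem inner_harmonicIm (f : L2S) (l : ℕ) (m : ℤ) :
    inner ℝ f (harmonicIm l m) = ∫ x, f x * (sphericalHarmonic l m x).im ∂sphereMeasure := by
  rw [L2.inner_def]
  refine integral_congr_ae ?_
  filter_upwards [(memLp_harmonic_im l m).coeFn_toLp] with x hx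
  rw [harmonicIm, hx]
  simp [mul_comm]

/-- Both parts become real inner products, to which the law of the Q-Wiener process applies; the
minus sign comes from the conjugate. -/
theorem fourierCoeff_eq (f : L2S) (l : ℕ) (m : ℤ) :
    fourierCoeff f l m =
      (inner ℝ f (harmonicRe l m) : ℂ) + (inner ℝ f (-harmonicIm l m) : ℂ) * Complex.I := by
  rw [inner_neg_right, inner_harmonicRe, inner_harmonicIm, fourierCoeff]
  have h1 : Integrable (fun x => ((f x * (sphericalHarmonic l m x).re : ℝ) : ℂ)) sphereMeasure :=
    ((Lp.memLp f).integrable_mul (memLp_harmonic_re l m)).ofReal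
  have h2 : Integrable (fun x => ((f x * (sphericalHarmonic l m x).im : ℝ) : ℂ) * Complex.I)
      sphereMeasure :=
    (((Lp.memLp f).integrable_mul (memLp_harmonic_im l m)).ofReal (𝕜 := ℂ)).mul_const _
  rw [Complex.ofReal_neg, neg_mul, ← sub_eq_add_neg, ← integral_complex_ofReal,
    ← integral_complex_ofReal, ← integral_mul_const, ← integral_sub h1 h2]
  refine integral_congr_ae (Eventually.of_forall fun x => ?_)
  apply Complex.ext <;> simp

theorem norm_sq_harmonic (l : ℕ) (m : ℤ) (hm : m.natAbs ≤ l) :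
    ‖harmonicRe l m‖ ^ 2 + ‖-harmonicIm l m‖ ^ 2 = 1 := by
  rw [norm_neg, ← real_inner_self_eq_norm_sq, ← real_inner_self_eq_norm_sq, inner_harmonicRe,
    inner_harmonicIm]
  have h1 : ∫ x, harmonicRe l m x * (sphericalHarmonic l m x).re ∂sphereMeasure =
      ∫ x, (sphericalHarmonic l m x).re ^ 2 ∂sphereMeasure := by
    refine integral_congr_ae ?_
    filter_upwards [(memLp_harmonic_re l m).coeFn_toLp] with x hx
    rw [harmonicRe, hx, sq]
  have h2 : ∫ x, harmonicIm l m x * (sphericalHarmonic l m x).im ∂sphereMeasure =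
      ∫ x, (sphericalHarmonic l m x).im ^ 2 ∂sphereMeasure := by
    refine integral_congr_ae ?_
    filter_upwards [(memLp_harmonic_im l m).coeFn_toLp] with x hx
    rw [harmonicIm, hx, sq]
  rw [h1, h2, ← integral_add (memLp_harmonic_re l m).integrable_sq
    (memLp_harmonic_im l m).integrable_sq]
  have h3 := integral_sphericalHarmonic_mul_conj hm hm
  rw [if_pos ⟨rfl, rfl⟩] at h3
  have h4 : ∀ x, sphericalHarmonic l m x * starRingEnd ℂ (sphericalHarmonic l m x) =
      (((sphericalHarmonic l m x).re ^ 2 + (sphericalHarmonic l m x).im ^ 2 : ℝ) : ℂ) := fun x => by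
    rw [Complex.mul_conj, Complex.normSq_apply, sq, sq]
  simp only [h4] at h3
  rw [integral_complex_ofReal] at h3
  exact_mod_cast h3

variable {Ω : Type*} [MeasurableSpace Ω] {P : Measure Ω}

theorem aestronglyMeasurable_fourierCoeff_comp {X : Ω → L2S} (hX : Measurable X) (l : ℕ) (m : ℤ) :
    AEStronglyMeasurable (fun ω => fourierCoeff (X ω) l m) P := by
  have h : ∀ f : L2S, Measurable fun ω => inner ℝ (X ω) f := fun f =>
    (continuous_id.inner continuous_const).measurable.comp hX
  simp only [fourierCoeff_eq]
  exact ((Complex.measurable_ofReal.comp (h _)).add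
    ((Complex.measurable_ofReal.comp (h _)).mul_const _)).aestronglyMeasurable

theorem IsDelayedQWiener.isScaledWiener {τ : ℝ} {Q : L2S →L[ℝ] L2S} {W : ℝ → Ω → L2S}
    (hW : IsDelayedQWiener P τ Q W) (hQ : Q.IsPositive) (f : L2S) :
    IsScaledWiener P (inner ℝ (Q f) f) fun s ω => inner ℝ (W (τ + s) ω) f where
  nonneg := hQ.inner_nonneg_left f
  law s t hs hst := by
    have h := hW.law_increments (τ + s) (τ + t) (by linarith) (by linarith) f
    simpa only [inner_sub_left, add_sub_add_left_eq_sub] using h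
  indep s t hs hst := by
    have hm : Measurable fun g : L2S => inner ℝ g f :=
      (continuous_id.inner continuous_const).measurable
    have h := (hW.indep_increments.indepFun_sub_sub (r := ⟨τ + 0, by simp⟩)
      (s := ⟨τ + s, by simpa using hs⟩) (t := ⟨τ + t, by simpa using hs.trans hst⟩)
      (by simpa using hs) (by simpa using hst)).comp hm hm
    convert h using 1
    · ext ω; simp [inner_sub_left]
    · ext ω; simp [inner_sub_left]

/-- The increments of the coefficients of the inhomogeneous part. -/
theorem eLpNorm_coefficient_increment_le {α τ : ℝ} (hα : 0 < α) (hα1 : α ≤ 1)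
    {Q : L2S →L[ℝ] L2S} {a : ℕ → ℝ} {W : ℝ → Ω → L2S} (hQ : IsIsotropicCovariance Q a)
    (hW : IsDelayedQWiener P τ Q W) {l : ℕ} {m : ℤ} (hm1 : -(l : ℤ) ≤ m) (hm2 : m ≤ (l : ℤ))
    {b d : ℝ} (hd : 0 ≤ d) (hdb : d ≤ b) {I J : Ω → ℂ}
    (hI : IsWienerIntegral P (fun s ω => fourierCoeff (W (τ + s) ω) l m) 0 b
      (fun s => mittagLeffler α (-eigenvalue l * (b - s) ^ α)) I)
    (hJ : IsWienerIntegral P (fun s ω => fourierCoeff (W (τ + s) ω) l m) 0 d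
      (fun s => mittagLeffler α (-eigenvalue l * (d - s) ^ α)) J) :
    0 ≤ a l ∧ ∫⁻ ω, ‖I ω - J ω‖ₑ ^ 2 ∂P ≤ ENNReal.ofReal (a l * (2 * (b - d))) := by
  have hl : 0 ≤ eigenvalue l := by unfold eigenvalue; positivity
  have q1 : Q (harmonicRe l m) = a l • harmonicRe l m :=
    hQ.eigen_re l m hm1 hm2 _ (memLp_harmonic_re l m).coeFn_toLp
  have q2 : Q (-harmonicIm l m) = a l • -harmonicIm l m := by
    rw [map_neg, hQ.eigen_im l m hm1 hm2 (harmonicIm l m) (memLp_harmonic_im l m).coeFn_toLp, smul_neg]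
  have w1 := hW.isScaledWiener hQ.positive (harmonicRe l m)
  have w2 := hW.isScaledWiener hQ.positive (-harmonicIm l m)
  -- The unit norm of the harmonic splits between its real and imaginary parts, so the two variances
  -- add up to `a l`.
  have hsum : inner ℝ (Q (harmonicRe l m)) (harmonicRe l m) +
      inner ℝ (Q (-harmonicIm l m)) (-harmonicIm l m) = a l := by
    rw [q1, q2, real_inner_smul_left, real_inner_smul_left, real_inner_self_eq_norm_sq,
      real_inner_self_eq_norm_sq, ← mul_add, norm_sq_harmonic l m (by omega), mul_one]
  have ha : 0 ≤ a l := hsum ▸ add_nonneg w1.nonneg w2.nonneg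
  refine ⟨ha, ?_⟩
  have h := eLpNorm_wienerIntegral_sub_le (P := P)
    (B := fun s ω => fourierCoeff (W (τ + s) ω) l m)
    (v₁ := inner ℝ (Q (harmonicRe l m)) (harmonicRe l m))
    (v₂ := inner ℝ (Q (-harmonicIm l m)) (-harmonicIm l m))
    (by simpa [fourierCoeff_eq] using w1) (by simpa [fourierCoeff_eq] using w2)
    (fun t ht => aestronglyMeasurable_fourierCoeff_comp (hW.measurable _ (by linarith)) l m)
    (aestronglyMeasurable_indicator_relaxation hα hα1 hl b)
    (aestronglyMeasurable_indicator_relaxation hα hα1 hl d) hI hJ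
  rw [hsum] at h
  have h2 := h.trans (mul_le_mul_right (eLpNorm_relaxation_sub_le hα hα1 hl hd hdb) _)
  rw [← eLpNorm_two_sq]
  refine (ENNReal.pow_le_pow_left_iff two_ne_zero).2 h2 |>.trans (le_of_eq ?_)
  rw [← ENNReal.ofReal_mul (Real.sqrt_nonneg _), ← Real.sqrt_mul ha,
    ← ENNReal.ofReal_pow (Real.sqrt_nonneg _), Real.sq_sqrt (mul_nonneg ha (by linarith))]

/-- The Fourier coefficients of a square integrable field are square integrable. -/
theorem memLp_fourierCoeff [SFinite P] {ξ : Ω → S2 → ℝ}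
    (hξ : Measurable fun z : Ω × S2 => ξ z.1 z.2)
    (hξ2 : MemLp (fun z : Ω × S2 => ξ z.1 z.2) 2 (P.prod sphereMeasure)) (l : ℕ) (m : ℤ) :
    MemLp (fun ω => fourierCoeff (ξ ω) l m) 2 P := by
  have hY : Continuous fun x => starRingEnd ℂ (sphericalHarmonic l m x) :=
    Complex.continuous_conj.comp (continuous_sphericalHarmonic l m)
  have hmeas : Measurable fun z : Ω × S2 =>
      (ξ z.1 z.2 : ℂ) * starRingEnd ℂ (sphericalHarmonic l m z.2) :=
    (Complex.measurable_ofReal.comp hξ).mul (hY.measurable.comp measurable_snd)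
  refine ⟨(hmeas.stronglyMeasurable.integral_prod_right').aestronglyMeasurable, ?_⟩
  set M := eLpNorm (fun x => starRingEnd ℂ (sphericalHarmonic l m x)) 2 sphereMeasure with hM
  have hMtop : M < ⊤ := (memLp_of_continuous hY).2
  -- Cauchy–Schwarz for each ω; Tonelli then integrates the right side. Working in `ENNReal` covers
  -- the ω for which the field is not square integrable.
  have h1 : ∀ ω, ‖fourierCoeff (ξ ω) l m‖ₑ ^ 2 ≤ (∫⁻ x, ‖ξ ω x‖ₑ ^ 2 ∂sphereMeasure) * M ^ 2 := by
    intro ω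
    have hω : Measurable fun x => (ξ ω x : ℂ) :=
      Complex.measurable_ofReal.comp (hξ.comp measurable_prodMk_left)
    have h2 := eLpNorm_smul_le_mul_eLpNorm (p := 2) (q := 2) (r := 1) (μ := sphereMeasure)
      hY.aestronglyMeasurable hω.aestronglyMeasurable
    have h3 : eLpNorm (fun x => (ξ ω x : ℂ)) 2 sphereMeasure ^ 2 =
        ∫⁻ x, ‖ξ ω x‖ₑ ^ 2 ∂sphereMeasure := by
      rw [eLpNorm_two_sq]
      refine lintegral_congr fun x => ?_
      rw [← ofReal_norm, ← ofReal_norm, Complex.norm_real]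
    rw [← h3, ← mul_pow]
    refine (ENNReal.pow_le_pow_left_iff two_ne_zero).2 (le_trans ?_ h2)
    rw [eLpNorm_one_eq_lintegral_enorm]
    exact enorm_integral_le_lintegral_enorm _
  have h4 : ∫⁻ ω, ∫⁻ x, ‖ξ ω x‖ₑ ^ 2 ∂sphereMeasure ∂P < ⊤ := by
    have h5 := lintegral_prod (μ := P) (ν := sphereMeasure)
      (fun z : Ω × S2 => ‖ξ z.1 z.2‖ₑ ^ 2) (hξ.enorm.pow_const 2).aemeasurable
    rw [← eLpNorm_two_sq] at h5
    rw [← h5]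
    exact ENNReal.pow_lt_top hξ2.2
  have h6 : eLpNorm (fun ω => fourierCoeff (ξ ω) l m) 2 P ^ 2 < ⊤ := by
    rw [eLpNorm_two_sq]
    refine (lintegral_mono h1).trans_lt ?_
    rw [lintegral_mul_const' _ _ (ENNReal.pow_lt_top hMtop).ne]
    exact ENNReal.mul_lt_top h4 (ENNReal.pow_lt_top hMtop)
  by_contra hc
  rw [not_lt_top_iff.1 hc] at h6
  simp at h6

end Fourier

/-! ### Mean square estimates for expansions -/

section Expansion

variable {Ω : Type*} [MeasurableSpace Ω] {P : Measure Ω}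

theorem aestronglyMeasurable_expansion [SFinite P] (s : Finset ((_ : ℕ) × ℤ)) {b : ℕ → ℤ → Ω → ℂ}
    (hb : ∀ p ∈ s, AEStronglyMeasurable (b p.1 p.2) P) :
    AEStronglyMeasurable (fun z : Ω × S2 =>
      ∑ p ∈ s, b p.1 p.2 z.1 * sphericalHarmonic p.1 p.2 z.2) (P.prod sphereMeasure) :=
  Finset.aestronglyMeasurable_fun_sum _ fun p hp => (hb p hp).comp_fst.mul
    (continuous_sphericalHarmonic p.1 p.2).aestronglyMeasurable.comp_snd

theorem lintegral_expansion [SFinite P] (s : Finset ((_ : ℕ) × ℤ))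
    (hs : ∀ p ∈ s, p.2.natAbs ≤ p.1) {b : ℕ → ℤ → Ω → ℂ}
    (hb : ∀ p ∈ s, AEStronglyMeasurable (b p.1 p.2) P) :
    ∫⁻ z : Ω × S2, ‖∑ p ∈ s, b p.1 p.2 z.1 * sphericalHarmonic p.1 p.2 z.2‖ₑ ^ 2
      ∂(P.prod sphereMeasure) = ∑ p ∈ s, ∫⁻ ω, ‖b p.1 p.2 ω‖ₑ ^ 2 ∂P := by
  rw [lintegral_prod _ ((aestronglyMeasurable_expansion s hb).enorm.pow_const 2),
    ← lintegral_finsetSum' _ fun p hp => (hb p hp).enorm.pow_const 2]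
  refine lintegral_congr fun ω => ?_
  have hc : Continuous fun x => ∑ p ∈ s, b p.1 p.2 ω * sphericalHarmonic p.1 p.2 x :=
    continuous_finsetSum _ fun p _ => continuous_const.mul (continuous_sphericalHarmonic p.1 p.2)
  rw [lintegral_enorm_sq_eq_ofReal (memLp_of_continuous hc),
    integral_norm_sq_sum s hs fun p => b p.1 p.2 ω,
    ENNReal.ofReal_sum_of_nonneg fun p _ => by positivity]
  refine Finset.sum_congr rfl fun p _ => ?_
  rw [ENNReal.ofReal_pow (norm_nonneg _), ofReal_norm]

/-- Parseval bounds the difference of the truncated expansions by K, the factor 2l + 1 counting the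
orders. The bound is uniform in L, so it survives the limit. -/
theorem eLpNorm_expansion_sub_le [SFinite P] {b b' : ℕ → ℤ → Ω → ℂ} {u u' : Ω × S2 → ℝ}
    {w : ℕ → ℝ} {K : ℝ}
    (hb : ∀ (l : ℕ) (m : ℤ), -(l : ℤ) ≤ m → m ≤ l → AEStronglyMeasurable (b l m) P)
    (hb' : ∀ (l : ℕ) (m : ℤ), -(l : ℤ) ≤ m → m ≤ l → AEStronglyMeasurable (b' l m) P)
    (hu : IsL2Expansion P b u) (hu' : IsL2Expansion P b' u') (hw : ∀ l, 0 ≤ w l)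
    (hbw : ∀ (l : ℕ) (m : ℤ), -(l : ℤ) ≤ m → m ≤ l →
      ∫⁻ ω, ‖b l m ω - b' l m ω‖ₑ ^ 2 ∂P ≤ ENNReal.ofReal (w l))
    (hK : ∀ L : ℕ, ∑ l ∈ Finset.range (L + 1), (2 * (l : ℝ) + 1) * w l ≤ K) :
    eLpNorm (fun z => u z - u' z) 2 (P.prod sphereMeasure) ≤ ENNReal.ofReal (Real.sqrt K) := by
  obtain ⟨mu, hu⟩ := hu
  obtain ⟨mu', hu'⟩ := hu'
  set s : ℕ → Finset ((_ : ℕ) × ℤ) := fun L =>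
    (Finset.range (L + 1)).sigma fun l => Finset.Icc (-(l : ℤ)) l with hs
  have hmem : ∀ {L : ℕ} {p : (_ : ℕ) × ℤ}, p ∈ s L → -(p.1 : ℤ) ≤ p.2 ∧ p.2 ≤ p.1 :=
    fun hp => Finset.mem_Icc.1 (Finset.mem_sigma.1 hp).2
  have hsum : ∀ (c : ℕ → ℤ → Ω → ℂ) (L : ℕ) (z : Ω × S2),
      ∑ l ∈ Finset.range (L + 1), ∑ m ∈ Finset.Icc (-(l : ℤ)) (l : ℤ),
        c l m z.1 * sphericalHarmonic l m z.2 =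
      ∑ p ∈ s L, c p.1 p.2 z.1 * sphericalHarmonic p.1 p.2 z.2 := fun c L z => by
    rw [hs, Finset.sum_sigma]
  simp only [hsum] at hu hu'
  have hlim := (hu.add (tendsto_const_nhds (x := ENNReal.ofReal (Real.sqrt K)))).add hu'
  rw [zero_add, add_zero] at hlim
  refine ge_of_tendsto' hlim fun L => ?_
  have ms := aestronglyMeasurable_expansion (s L) fun p hp => hb _ _ (hmem hp).1 (hmem hp).2
  have ms' := aestronglyMeasurable_expansion (s L) fun p hp => hb' _ _ (hmem hp).1 (hmem hp).2
  set S := fun z : Ω × S2 => ∑ p ∈ s L, b p.1 p.2 z.1 * sphericalHarmonic p.1 p.2 z.2 with hS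
  set S' := fun z : Ω × S2 => ∑ p ∈ s L, b' p.1 p.2 z.1 * sphericalHarmonic p.1 p.2 z.2 with hS'
  have mid : eLpNorm (fun z => S z - S' z) 2 (P.prod sphereMeasure) ≤
      ENNReal.ofReal (Real.sqrt K) := by
    refine eLpNorm_two_le_sqrt ?_
    have e : ∀ z, S z - S' z = ∑ p ∈ s L,
        (fun l m ω => b l m ω - b' l m ω) p.1 p.2 z.1 * sphericalHarmonic p.1 p.2 z.2 := fun z => by
      simp only [hS, hS', ← Finset.sum_sub_distrib, sub_mul]
    simp only [e]
    rw [lintegral_expansion (b := fun l m ω => b l m ω - b' l m ω) (s L)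
      (fun p hp => by have := hmem hp; omega)
      fun p hp => (hb _ _ (hmem hp).1 (hmem hp).2).sub (hb' _ _ (hmem hp).1 (hmem hp).2)]
    calc ∑ p ∈ s L, ∫⁻ ω, ‖b p.1 p.2 ω - b' p.1 p.2 ω‖ₑ ^ 2 ∂P
        ≤ ∑ p ∈ s L, ENNReal.ofReal (w p.1) :=
          Finset.sum_le_sum fun p hp => hbw _ _ (hmem hp).1 (hmem hp).2
      _ = ENNReal.ofReal (∑ l ∈ Finset.range (L + 1), (2 * (l : ℝ) + 1) * w l) := by
          rw [← ENNReal.ofReal_sum_of_nonneg fun p _ => hw p.1, hs, Finset.sum_sigma]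
          congr 1
          refine Finset.sum_congr rfl fun l _ => ?_
          have hcard : (Finset.Icc (-(l : ℤ)) l).card = 2 * l + 1 := by
            rw [Int.card_Icc]; omega
          simp only [Finset.sum_const, hcard, nsmul_eq_mul]
          push_cast
          ring
      _ ≤ ENNReal.ofReal K := ENNReal.ofReal_le_ofReal (hK L)
  have toC : ∀ {v : Ω × S2 → ℝ}, MemLp v 2 (P.prod sphereMeasure) →
      AEStronglyMeasurable (fun z => (v z : ℂ)) (P.prod sphereMeasure) :=
    fun hv => Complex.continuous_ofReal.comp_aestronglyMeasurable hv.1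
  have e1 : eLpNorm (fun z => u z - u' z) 2 (P.prod sphereMeasure) =
      eLpNorm ((fun z => (u z : ℂ) - S z) + (fun z => S z - S' z) - fun z => (u' z : ℂ) - S' z) 2
        (P.prod sphereMeasure) := by
    refine eLpNorm_congr_norm_ae (Eventually.of_forall fun z => ?_)
    simp only [Pi.add_apply, Pi.sub_apply]
    rw [← Complex.norm_real]
    congr 1
    push_cast
    ring
  rw [e1]
  have n1 := (toC mu).sub ms
  have n2 := ms.sub ms'
  have n3 := (toC mu').sub ms'
  refine (eLpNorm_sub_le (n1.add n2) n3 one_le_two).trans (add_le_add_left ?_ _)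
  exact (eLpNorm_add_le n1 n2 one_le_two).trans (add_le_add_right mid _)

/-! ### The series of the spectrum -/

/-- The series `∑ (2 l + 1) l ^ (-κ)` over `l ≥ 1`. -/
def spectralSeries (κ : ℝ) : ℝ := ∑' l : ℕ, (2 * (l : ℝ) + 1) * (l : ℝ) ^ (-κ)

theorem summable_spectralSeries {κ : ℝ} (hκ : 2 < κ) :
    Summable fun l : ℕ => (2 * (l : ℝ) + 1) * (l : ℝ) ^ (-κ) := by
  have h := (Real.summable_nat_rpow.2 (show 1 - κ < -1 by linarith)).mul_left 3
  refine Summable.of_nonneg_of_le (fun l => by positivity) (fun l => ?_) h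
  rcases Nat.eq_zero_or_pos l with rfl | hl
  -- `Real.rpow` gives 0 ^ (-κ) = 0 here, so the series effectively starts at l = 1.
  · rw [Nat.cast_zero, Real.zero_rpow (by linarith), Real.zero_rpow (by linarith)]
    simp
  · have hl' : (1 : ℝ) ≤ l := by exact_mod_cast hl
    rw [sub_eq_add_neg, Real.rpow_add (by linarith), Real.rpow_one, ← mul_assoc]
    gcongr
    linarith

theorem sum_le_spectralSeries {κ : ℝ} (hκ : 2 < κ) (s : Finset ℕ) :
    ∑ l ∈ s, (2 * (l : ℝ) + 1) * (l : ℝ) ^ (-κ) ≤ spectralSeries κ :=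
  (summable_spectralSeries hκ).sum_le_tsum s fun l _ => by positivity

/-! ### Temporal increments of the two parts of the solution -/

theorem eLpNorm_homogeneous_increment_le [SFinite P] {α : ℝ} (hα : 0 < α) (hα1 : α ≤ 1)
    {ξ : Ω → S2 → ℝ} {c : ℕ → ℝ} {A κ : ℝ} (hκ : 2 < κ) (hA : 0 ≤ A)
    (hξ : Measurable fun z : Ω × S2 => ξ z.1 z.2)
    (hξ2 : MemLp (fun z : Ω × S2 => ξ z.1 z.2) 2 (P.prod sphereMeasure))
    (hc : HasAngularPowerSpectrum P ξ c) (hcA : ∀ l : ℕ, 1 ≤ l → c l ≤ A * (l : ℝ) ^ (-κ))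
    {UH : ℝ → Ω × S2 → ℝ} (hU : IsHomogeneousPart P α ξ UH) {t h : ℝ} (ht : 0 < t) (hh : 0 < h) :
    eLpNorm (fun z => UH (t + h) z - UH t z) 2 (P.prod sphereMeasure) ≤
      ENNReal.ofReal (Real.sqrt (h / t * (A * spectralSeries κ))) := by
  have hm : ∀ l m, MemLp (fun ω => fourierCoeff (ξ ω) l m) 2 P := memLp_fourierCoeff hξ hξ2
  refine eLpNorm_expansion_sub_le (w := fun l => h / t * (A * (l : ℝ) ^ (-κ)))
    (fun l m _ _ => (hm l m).1.const_mul _) (fun l m _ _ => (hm l m).1.const_mul _)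
    (hU (t + h) (by linarith)) (hU t ht) (fun l => by positivity) ?_ fun L => ?_
  · intro l m h1 h2
    have hl : 0 ≤ eigenvalue l := by unfold eigenvalue; positivity
    set r := relaxation α (eigenvalue l) with hr
    have e : ∀ ω, (mittagLeffler α (-eigenvalue l * (t + h) ^ α) : ℂ) * fourierCoeff (ξ ω) l m -
        (mittagLeffler α (-eigenvalue l * t ^ α) : ℂ) * fourierCoeff (ξ ω) l m =
        ((r (t + h) - r t : ℝ) : ℂ) * fourierCoeff (ξ ω) l m := fun ω => by
      rw [hr, relaxation, relaxation]; push_cast; ring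
    simp only [e]
    rw [lintegral_enorm_sq_eq_ofReal ((hm l m).const_mul _)]
    refine ENNReal.ofReal_le_ofReal ?_
    simp only [norm_mul, mul_pow, Complex.norm_real]
    rw [integral_const_mul, hc l m h1 h2, Real.norm_eq_abs, sq_abs]
    have hc0 : 0 ≤ c l := by
      rw [← hc l m h1 h2]; exact integral_nonneg fun ω => by positivity
    -- The eigenvalue at l = 0 is zero, so that mode is constant in time and c 0 does not enter the
    -- bound.
    rcases Nat.eq_zero_or_pos l with rfl | hl0
    · have hz : r (t + h) - r t = 0 := by
        simp [hr, relaxation, eigenvalue]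
      rw [hz]
      simp only [ne_eq, OfNat.ofNat_ne_zero, not_false_eq_true, zero_pow, zero_mul]
      positivity
    · have d0 : r (t + h) ≤ r t := relaxation_antitoneOn hα hα1 hl ht.le
        (by simp only [Set.mem_Ici]; linarith) (by linarith)
      have d1 := relaxation_sub_le hα hα1 hl ht hh.le
      have d2 := relaxation_le_one hα hα1 hl ht.le
      have d3 := relaxation_nonneg hα hα1 hl (show 0 ≤ t + h by linarith)
      simp only [← hr] at d1 d2 d3
      have d4 : (r (t + h) - r t) ^ 2 ≤ h / t := by nlinarith
      exact mul_le_mul d4 (hcA l hl0) hc0 (by positivity)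
  · have := sum_le_spectralSeries hκ (Finset.range (L + 1))
    calc ∑ l ∈ Finset.range (L + 1), (2 * (l : ℝ) + 1) * (h / t * (A * (l : ℝ) ^ (-κ)))
        = h / t * (A * ∑ l ∈ Finset.range (L + 1), (2 * (l : ℝ) + 1) * (l : ℝ) ^ (-κ)) := by
          rw [Finset.mul_sum, Finset.mul_sum]
          exact Finset.sum_congr rfl fun l _ => by ring
      _ ≤ h / t * (A * spectralSeries κ) := by gcongr

theorem eLpNorm_inhomogeneous_increment_le [SFinite P] {α τ : ℝ} (hα : 0 < α) (hα1 : α ≤ 1)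
    {Q : L2S →L[ℝ] L2S} {a : ℕ → ℝ} {W : ℝ → Ω → L2S} {K A κ : ℝ} (hκ : 2 < κ) (hK : 0 ≤ K)
    (hA : 0 ≤ A) (hQ : IsIsotropicCovariance Q a) (hW : IsDelayedQWiener P τ Q W) (ha0 : a 0 ≤ K)
    (haA : ∀ l : ℕ, 1 ≤ l → a l ≤ A * (l : ℝ) ^ (-κ)) {UI : ℝ → Ω × S2 → ℝ}
    (hU : IsInhomogeneousPart P α τ W UI) {t h : ℝ} (ht : τ < t) (hh : 0 < h) :
    eLpNorm (fun z => UI (t + h) z - UI t z) 2 (P.prod sphereMeasure) ≤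
      ENNReal.ofReal (Real.sqrt (2 * h * (K + A * spectralSeries κ))) := by
  obtain ⟨I, hI, hI2⟩ := hU.2 (t + h) (by linarith)
  obtain ⟨J, hJ, hJ2⟩ := hU.2 t ht
  refine eLpNorm_expansion_sub_le
    -- The undamped mode l = 0 does feel the noise and contributes K; the power term vanishes there.
    (w := fun l => 2 * h * ((if l = 0 then K else 0) + A * (l : ℝ) ^ (-κ)))
    (fun l m h1 h2 => (hI l m h1 h2).1.1) (fun l m h1 h2 => (hJ l m h1 h2).1.1) hI2 hJ2
    (fun l => by split_ifs <;> positivity) ?_ fun L => ?_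
  · intro l m h1 h2
    obtain ⟨ha, hb⟩ := eLpNorm_coefficient_increment_le hα hα1 hQ hW h1 h2
      (by linarith : 0 ≤ t - τ) (by linarith : t - τ ≤ t + h - τ) (hI l m h1 h2) (hJ l m h1 h2)
    refine hb.trans (ENNReal.ofReal_le_ofReal ?_)
    have hal : a l ≤ (if l = 0 then K else 0) + A * (l : ℝ) ^ (-κ) := by
      split_ifs with hl
      · subst hl
        exact le_add_of_le_of_nonneg ha0 (by positivity)
      · rw [zero_add]
        exact haA l (by omega)
    rw [show a l * (2 * (t + h - τ - (t - τ))) = 2 * h * a l by ring]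
    gcongr
  · have := sum_le_spectralSeries hκ (Finset.range (L + 1))
    calc ∑ l ∈ Finset.range (L + 1),
          (2 * (l : ℝ) + 1) * (2 * h * ((if l = 0 then K else 0) + A * (l : ℝ) ^ (-κ)))
        = 2 * h * (∑ l ∈ Finset.range (L + 1), (2 * (l : ℝ) + 1) * (if l = 0 then K else 0) +
            A * ∑ l ∈ Finset.range (L + 1), (2 * (l : ℝ) + 1) * (l : ℝ) ^ (-κ)) := by
          rw [Finset.mul_sum (a := A), ← Finset.sum_add_distrib, Finset.mul_sum]
          exact Finset.sum_congr rfl fun l _ => by ring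
      _ = 2 * h * (K + A * ∑ l ∈ Finset.range (L + 1), (2 * (l : ℝ) + 1) * (l : ℝ) ^ (-κ)) := by
          simp
      _ ≤ 2 * h * (K + A * spectralSeries κ) := by gcongr

theorem ofReal_sqrt_add_le {x y z : ℝ} (hx : 0 ≤ x) (hy : 0 ≤ y) (h : 2 * x + 2 * y ≤ z) :
    ENNReal.ofReal (Real.sqrt x) + ENNReal.ofReal (Real.sqrt y) ≤ ENNReal.ofReal (Real.sqrt z) := by
  rw [← ENNReal.ofReal_add (Real.sqrt_nonneg _) (Real.sqrt_nonneg _)]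
  refine ENNReal.ofReal_le_ofReal (Real.le_sqrt_of_sq_le ?_)
  nlinarith [Real.sq_sqrt hx, Real.sq_sqrt hy, sq_nonneg (Real.sqrt x - Real.sqrt y)]

end Expansion

end SphereDiffusion

end

/-! ### The main estimate. -/

theorem theorem6p1 (α κ₁ κ₂ ρ : ℝ) (hα : 0 < α) (hα1 : α ≤ 1) (hκ₁ : 2 < κ₁) (hκ₂ : 2 < κ₂) :
    ∃ C : ℝ, 0 < C ∧
      ∀ (Dt Ct Kt At : ℝ), 0 < Dt → 0 < Ct → 0 < Kt → 0 < At → Kt ≤ ρ * At →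
      ∀ {Ω : Type*} [MeasurableSpace Ω] (P : MeasureTheory.Measure Ω)
        [MeasureTheory.IsProbabilityMeasure P] (τ : ℝ), 0 < τ →
      -- the initial field and its angular power spectrum
      ∀ (ξ : Ω → SphereDiffusion.S2 → ℝ) (c : ℕ → ℝ),
        SphereDiffusion.IsIsotropicGaussianField P ξ →
        SphereDiffusion.HasAngularPowerSpectrum P ξ c →
        c 0 ≤ Dt → (∀ l : ℕ, 1 ≤ l → c l ≤ Ct * (l : ℝ) ^ (-κ₁)) →
      -- the noise and its angular power spectrum
      ∀ (Q : SphereDiffusion.L2S →L[ℝ] SphereDiffusion.L2S) (a : ℕ → ℝ)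
        (W : ℝ → Ω → SphereDiffusion.L2S),
        SphereDiffusion.IsIsotropicCovariance Q a →
        SphereDiffusion.IsDelayedQWiener P τ Q W →
        a 0 ≤ Kt → (∀ l : ℕ, 1 ≤ l → a l ≤ At * (l : ℝ) ^ (-κ₂)) →
      -- the initial field is independent of the noise
        ProbabilityTheory.IndepFun ξ (fun ω (t : Set.Ici τ) => W (t : ℝ) ω) P →
      -- the solution and its temporal increments
      ∀ (U : ℝ → Ω × SphereDiffusion.S2 → ℝ), SphereDiffusion.IsSolution P α τ ξ W U →
      ∀ t : ℝ, τ < t → ∀ h : ℝ, 0 < h →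
        MeasureTheory.eLpNorm (fun z => U (t + h) z - U t z) 2
            (P.prod SphereDiffusion.sphereMeasure) ≤
          ENNReal.ofReal
            (Real.sqrt (C * SphereDiffusion.spectralConst Ct κ₁ ^ 2 * t⁻¹ +
                (1 + C) * SphereDiffusion.spectralConst At κ₂ ^ 2) * h ^ ((1 : ℝ) / 2)) := by
  set β₁ := 2 / (κ₁ - 2) + 1 / (κ₁ - 1) with hβ₁
  set β₂ := 2 / (κ₂ - 2) + 1 / (κ₂ - 1) with hβ₂
  have p₁ : 0 < β₁ := add_pos (div_pos two_pos (by linarith)) (div_pos one_pos (by linarith))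
  have p₂ : 0 < β₂ := add_pos (div_pos two_pos (by linarith)) (div_pos one_pos (by linarith))
  -- The 1 secures positivity. The other entries absorb the two parts after (√x + √y)² ≤ 2x + 2y:
  -- the first factor is that 2, and 4 is this 2 times the 2 from the kernel estimate, with `Kt ≤ ρ
  -- * At` inserted.
  set C := max 1 (max (2 * SphereDiffusion.spectralSeries κ₁ / β₁)
    (4 * (ρ + SphereDiffusion.spectralSeries κ₂) / β₂)) with hC
  have hC0 : 0 < C := lt_of_lt_of_le one_pos (le_max_left _ _)
  have hC1 : 2 * SphereDiffusion.spectralSeries κ₁ ≤ C * β₁ :=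
    (div_le_iff₀ p₁).1 ((le_max_left _ _).trans (le_max_right _ _))
  have hC2 : 4 * (ρ + SphereDiffusion.spectralSeries κ₂) ≤ C * β₂ :=
    (div_le_iff₀ p₂).1 ((le_max_right _ _).trans (le_max_right _ _))
  refine ⟨C, hC0, ?_⟩
  intro Dt Ct Kt At _ hCt hKt hAt hρ Ω _ P _ τ hτ ξ c hξ hc _ hcl Q a W hQ hW ha0 hal _ U hU t ht h hh
  obtain ⟨UH, UI, hUH, hUI, hUeq⟩ := hU
  have ht0 : 0 < t := hτ.trans ht
  have b₁ := SphereDiffusion.eLpNorm_homogeneous_increment_le hα hα1 hκ₁ hCt.le hξ.measurable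
    hξ.memLp hc hcl hUH ht0 hh
  have b₂ := SphereDiffusion.eLpNorm_inhomogeneous_increment_le hα hα1 hκ₂ hKt.le hAt.le hQ hW ha0
    hal hUI ht hh
  have hUI2 : ∀ s, τ < s → MeasureTheory.AEStronglyMeasurable (UI s)
      (P.prod SphereDiffusion.sphereMeasure) := fun s hs => by
    obtain ⟨J, -, hJ⟩ := hUI.2 s hs
    exact hJ.1.1
  have e : (fun z => U (t + h) z - U t z) =ᵐ[P.prod SphereDiffusion.sphereMeasure]
      (fun z => UH (t + h) z - UH t z) + fun z => UI (t + h) z - UI t z := by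
    filter_upwards [hUeq (t + h) (by linarith), hUeq t ht0] with z h1 h2
    simp only [h1, h2, Pi.add_apply]
    ring
  have s₁ : 0 ≤ SphereDiffusion.spectralSeries κ₁ := tsum_nonneg fun l => by positivity
  have s₂ : 0 ≤ SphereDiffusion.spectralSeries κ₂ := tsum_nonneg fun l => by positivity
  rw [MeasureTheory.eLpNorm_congr_ae e]
  refine (MeasureTheory.eLpNorm_add_le ((hUH _ (by linarith)).1.1.sub (hUH t ht0).1.1)
    ((hUI2 _ (by linarith)).sub (hUI2 t ht)) one_le_two).trans ((add_le_add b₁ b₂).trans ?_)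
  rw [← Real.sqrt_eq_rpow, SphereDiffusion.spectralConst, SphereDiffusion.spectralConst,
    Real.sq_sqrt (mul_nonneg hCt.le p₁.le), Real.sq_sqrt (mul_nonneg hAt.le p₂.le),
    ← Real.sqrt_mul' _ hh.le]
  refine SphereDiffusion.ofReal_sqrt_add_le (by positivity) (by positivity) ?_
  have f₁ : 2 * (h / t * (Ct * SphereDiffusion.spectralSeries κ₁)) ≤
      C * (Ct * β₁) * t⁻¹ * h := by
    have := mul_le_mul_of_nonneg_left hC1 (show 0 ≤ h * t⁻¹ * Ct by positivity)
    rw [div_eq_mul_inv]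
    linarith
  have f₂ : 2 * (2 * h * (Kt + At * SphereDiffusion.spectralSeries κ₂)) ≤
      (1 + C) * (At * β₂) * h := by
    have g₁ := mul_le_mul_of_nonneg_left hC2 (show 0 ≤ h * At by positivity)
    have g₂ := mul_le_mul_of_nonneg_left hρ hh.le
    have g₃ : 0 ≤ h * At * β₂ := by positivity
    linarith
  linarith
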